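/- Let $K\subset\mathbb{R}^n$ be a convex body (compact, convex, with non-empty interior) that contains the origin in its interior. Let $h_K(u)=\max\{\langle u,y\rangle:y\in K\}$ be its support function. A unit vector $u$ is an outer unit normal of $K$ at $x\in\partial K$ if $\langle x,u\rangle=h_K(u)$; for $\beta\subset\partial K$ let $\nu(K,\beta)\subset S^{n-1}$ be the set of all outer unit normals of $K$ at points of $\beta$, and for $\mathcal{H}^{n-1}$-almost every $x\in\partial K$ let $\nu_K(x)$ be the unique outer unit normal of $K$ at $x$. Let $C_0(K,\cdot)$ and $C_{n-1}(K,\cdot)$ be the Borel measures on $\partial K$ given by $$C_0(K,\beta)=\mathcal{H}^{n-1}(\nu(K,\beta)),\qquad C_{n-1}(K,\beta)=\mathcal{H}^{n-1}(\beta).$$ For a real number $p>0$ the $L_p$ affine surface area of $K$ is $$\Omega_p(K)=\inf_{g}\left\{\left(\int_{\partial K}g^{-n}(x)\,dC_0(K,x)\right)^{\frac{p}{n+p}}\left(\int_{\partial K} g^p(x)\,h_K(\nu_K(x))^{1-p}\,dC_{n-1}(K,x)\right)^{\frac{n}{n+p}}\right\},$$ where the infimum is taken over all positive continuous functions $g:\partial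 K\to\mathbb{R}$. Then for every real $p>0$, every such $K$, and every invertible linear map $\phi:\mathbb{R}^n\to\mathbb{R}^n$, the number $\Omega_p(K)$ is finite and $$\Omega_p(\phi K)=|\det\phi|^{\frac{n-p}{n+p}}\,\Omega_p(K).$$ -/

import Mathlib

open Set MeasureTheory Metric
open scoped ENNReal NNReal RealInnerProductSpace

noncomputable section

namespace LpAffine

variable {n : ℕ}

/-- The support function `h_K(u) = max {⟪u, y⟫ : y ∈ K}`. -/
def supportFn (K : ConvexBody (EuclideanSpace ℝ (Fin n))) (u : EuclideanSpace ℝ (Fin n)) : ℝ :=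
  sSup ((fun y => ⟪u, y⟫) '' (K : Set (EuclideanSpace ℝ (Fin n))))

/-- The spherical image `ν(K, β)`: all unit vectors `u` such that the supporting hyperplane
`{x : ⟪x, u⟫ = h_K(u)}` passes through some point of `β ∩ ∂K`. -/
def sphericalImage (K : ConvexBody (EuclideanSpace ℝ (Fin n)))
    (β : Set (EuclideanSpace ℝ (Fin n))) : Set (EuclideanSpace ℝ (Fin n)) :=
  {u | ‖u‖ = 1 ∧ ∃ x ∈ β, x ∈ frontier (K : Set (EuclideanSpace ℝ (Fin n))) ∧
    ⟪x, u⟫ = supportFn K u}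

/-- A boundary point is regular if it has exactly one outer unit normal. -/
def IsRegularPoint (K : ConvexBody (EuclideanSpace ℝ (Fin n)))
    (x : EuclideanSpace ℝ (Fin n)) : Prop :=
  x ∈ frontier (K : Set (EuclideanSpace ℝ (Fin n))) ∧ ∃! u, u ∈ sphericalImage K {x}

open Classical in
/-- The Gauss map `ν_K`, sending a regular boundary point to its unique outer unit normal. At
all other points (on `∂K` they form a set of zero `(n-1)`-dimensional Hausdorff measure) it has
the default value `0`. -/
def gaussMap (K : ConvexBody (EuclideanSpace ℝ (Fin n)))
    (x : EuclideanSpace ℝ (Fin n)) : EuclideanSpace ℝ (Fin n) :=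
  if h : IsRegularPoint K x then h.2.choose else 0

theorem gaussMap_mem (K : ConvexBody (EuclideanSpace ℝ (Fin n)))
    {x : EuclideanSpace ℝ (Fin n)} (h : IsRegularPoint K x) :
    gaussMap K x ∈ sphericalImage K {x} := by
  rw [gaussMap, dif_pos h]
  exact h.2.choose_spec.1

/-! ### The zeroth curvature measure -/

theorem inner_le_supportFn (K : ConvexBody (EuclideanSpace ℝ (Fin n)))
    (u : EuclideanSpace ℝ (Fin n)) {y : EuclideanSpace ℝ (Fin n)} (hy : y ∈ K) :
    ⟪u, y⟫ ≤ supportFn K u :=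
  le_csSup (K.isCompact.image (by fun_prop)).bddAbove (mem_image_of_mem _ hy)

theorem exists_supportFn_eq (K : ConvexBody (EuclideanSpace ℝ (Fin n)))
    (u : EuclideanSpace ℝ (Fin n)) : ∃ y ∈ K, supportFn K u = ⟪u, y⟫ := by
  obtain ⟨y, hy, h⟩ := (K.isCompact.image (f := fun y => ⟪u, y⟫) (by fun_prop)).sSup_mem
    (K.nonempty.image _)
  exact ⟨y, hy, h.symm⟩

theorem exists_lipschitzWith_supportFn (K : ConvexBody (EuclideanSpace ℝ (Fin n))) :
    ∃ C : ℝ≥0, LipschitzWith C (supportFn K) := by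
  obtain ⟨R, hR⟩ := K.isCompact.isBounded.exists_norm_le
  refine ⟨R.toNNReal, LipschitzWith.of_le_add_mul _ fun u v => ?_⟩
  obtain ⟨y, hy, h⟩ := exists_supportFn_eq K u
  have h1 := inner_le_supportFn K v hy
  have h2 : ⟪u, y⟫ = ⟪v, y⟫ + ⟪u - v, y⟫ := by rw [inner_sub_left]; ring
  have h3 : ⟪u - v, y⟫ ≤ ‖u - v‖ * ‖y‖ := real_inner_le_norm _ _
  have h4 : ‖y‖ ≤ R.toNNReal := (hR y hy).trans (Real.le_coe_toNNReal R)
  rw [dist_eq_norm]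
  nlinarith [norm_nonneg (u - v)]

theorem sphericalImage_mono (K : ConvexBody (EuclideanSpace ℝ (Fin n)))
    {s t : Set (EuclideanSpace ℝ (Fin n))} (h : s ⊆ t) :
    sphericalImage K s ⊆ sphericalImage K t := by
  rintro u ⟨hu, x, hx, hx'⟩
  exact ⟨hu, x, h hx, hx'⟩

theorem sphericalImage_union (K : ConvexBody (EuclideanSpace ℝ (Fin n)))
    (s t : Set (EuclideanSpace ℝ (Fin n))) :
    sphericalImage K (s ∪ t) = sphericalImage K s ∪ sphericalImage K t := by
  ext u
  simp only [sphericalImage, mem_union, mem_ofPred_eq]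
  grind

theorem isClosed_sphericalImage (K : ConvexBody (EuclideanSpace ℝ (Fin n)))
    {s : Set (EuclideanSpace ℝ (Fin n))} (hs : IsClosed s) :
    IsClosed (sphericalImage K s) := by
  obtain ⟨C, hC⟩ := exists_lipschitzWith_supportFn K
  have hcont : Continuous (supportFn K) := hC.continuous
  have hfr : IsCompact (frontier (K : Set (EuclideanSpace ℝ (Fin n)))) :=
    K.isCompact.of_isClosed_subset isClosed_frontier K.isClosed.frontier_subset
  have hk : IsCompact (((s ∩ frontier (K : Set (EuclideanSpace ℝ (Fin n)))) ×ˢ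
      sphere (0 : EuclideanSpace ℝ (Fin n)) 1) ∩ {q | ⟪q.1, q.2⟫ = supportFn K q.2}) :=
    ((hfr.inter_left hs).prod (isCompact_sphere _ _)).inter_right
      (isClosed_eq (by fun_prop) (by fun_prop))
  convert (hk.image continuous_snd).isClosed using 1
  ext u
  simp only [sphericalImage, mem_ofPred_eq, mem_image, mem_inter_iff, mem_prod, Prod.exists,
    mem_sphere, dist_zero_right]
  grind

/-- Unit vectors that are outer normals at two different points of `K`. -/
def singularNormals (K : ConvexBody (EuclideanSpace ℝ (Fin n))) :
    Set (EuclideanSpace ℝ (Fin n)) :=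
  {u | ‖u‖ = 1 ∧ ∃ x ∈ K, ∃ y ∈ K, x ≠ y ∧ ⟪u, x⟫ = supportFn K u ∧ ⟪u, y⟫ = supportFn K u}

theorem lipschitzWith_radial (e : EuclideanSpace ℝ (Fin n)) (he : ‖e‖ = 1) :
    LipschitzWith 2 (fun w : (ℝ ∙ e)ᗮ => ‖e + w‖⁻¹ • (e + (w : EuclideanSpace ℝ (Fin n)))) := by
  have hge : ∀ w : (ℝ ∙ e)ᗮ, 1 ≤ ‖e + (w : EuclideanSpace ℝ (Fin n))‖ := by
    intro w
    have hw : ⟪e, (w : EuclideanSpace ℝ (Fin n))⟫ = 0 :=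
      Submodule.mem_orthogonal_singleton_iff_inner_right.1 w.2
    have h1 : ⟪e, e + (w : EuclideanSpace ℝ (Fin n))⟫ = 1 := by
      rw [inner_add_right, hw, real_inner_self_eq_norm_sq, he]; norm_num
    have h2 := real_inner_le_norm e (e + (w : EuclideanSpace ℝ (Fin n)))
    rw [h1, he, one_mul] at h2
    exact h2
  refine LipschitzWith.of_dist_le_mul fun v w => ?_
  set x := e + (v : EuclideanSpace ℝ (Fin n)) with hx
  set y := e + (w : EuclideanSpace ℝ (Fin n)) with hy
  have hx1 : 1 ≤ ‖x‖ := hge v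
  have hy1 : 1 ≤ ‖y‖ := hge w
  have hd : dist v w = ‖x - y‖ := by
    rw [Subtype.dist_eq, dist_eq_norm, hx, hy]; congr 1; abel
  rw [hd, dist_eq_norm]
  have hxy : ‖x‖⁻¹ • x - ‖y‖⁻¹ • y = ‖x‖⁻¹ • (x - y) + (‖x‖⁻¹ - ‖y‖⁻¹) • y := by
    rw [smul_sub, sub_smul]; abel
  have h1 : ‖x‖⁻¹ ≤ 1 := inv_le_one_of_one_le₀ hx1
  have h2 : |‖x‖⁻¹ - ‖y‖⁻¹| * ‖y‖ = ‖x‖⁻¹ * |‖y‖ - ‖x‖| := by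
    have : ‖x‖⁻¹ - ‖y‖⁻¹ = ‖x‖⁻¹ * (‖y‖ - ‖x‖) * ‖y‖⁻¹ := by
      field_simp
    rw [this, abs_mul, abs_mul, abs_of_nonneg (inv_nonneg.2 (norm_nonneg x)),
      abs_of_nonneg (inv_nonneg.2 (norm_nonneg y))]
    field_simp
  have h3 : |‖y‖ - ‖x‖| ≤ ‖x - y‖ := by
    rw [abs_sub_comm]; exact abs_norm_sub_norm_le x y
  calc ‖‖x‖⁻¹ • x - ‖y‖⁻¹ • y‖
      ≤ ‖x‖⁻¹ * ‖x - y‖ + |‖x‖⁻¹ - ‖y‖⁻¹| * ‖y‖ := by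
        rw [hxy]
        refine (norm_add_le _ _).trans (le_of_eq ?_)
        rw [norm_smul, norm_smul, norm_inv, norm_norm, Real.norm_eq_abs]
    _ ≤ 1 * ‖x - y‖ + 1 * ‖x - y‖ := by
        rw [h2]; gcongr
    _ = ((2 : ℝ≥0) : ℝ) * ‖x - y‖ := by push_cast; ring

theorem null_singularNormals_inter (K : ConvexBody (EuclideanSpace ℝ (Fin n)))
    (e : EuclideanSpace ℝ (Fin n)) (he : ‖e‖ = 1) :
    μHE[n - 1] (singularNormals K ∩ {u | 0 < ⟪e, u⟫}) = 0 := by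
  have he0 : e ≠ 0 := by rintro rfl; simp at he
  have hn : Module.finrank ℝ (ℝ ∙ e)ᗮ = n - 1 := by
    have := Submodule.finrank_add_finrank_orthogonal (ℝ ∙ e)
    rw [finrank_span_singleton he0, finrank_euclideanSpace_fin] at this
    omega
  obtain ⟨C, hC⟩ := exists_lipschitzWith_supportFn K
  let f : (ℝ ∙ e)ᗮ → ℝ := fun w => supportFn K (e + w)
  have hf : LipschitzWith C f := by
    refine LipschitzWith.of_dist_le_mul fun v w => ?_
    simpa [f, Subtype.dist_eq] using hC.dist_le_mul (e + (v : EuclideanSpace ℝ (Fin n))) (e + w)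
  have hae : ∀ᵐ w ∂(μHE[Module.finrank ℝ (ℝ ∙ e)ᗮ] : Measure (ℝ ∙ e)ᗮ),
      DifferentiableAt ℝ f w := hf.ae_differentiableAt
  rw [hn] at hae
  have hnull : (μHE[n - 1] : Measure (ℝ ∙ e)ᗮ) {w | ¬ DifferentiableAt ℝ f w} = 0 := hae
  have hnull2 : (μHE[n - 1] : Measure (EuclideanSpace ℝ (Fin n)))
      ((fun w : (ℝ ∙ e)ᗮ => ‖e + w‖⁻¹ • (e + (w : EuclideanSpace ℝ (Fin n)))) ''
        {w | ¬ DifferentiableAt ℝ f w}) = 0 := by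
    have hle := (lipschitzWith_radial e he).hausdorffMeasure_image_le
      (d := ((n - 1 : ℕ) : ℝ)) (by positivity) {w | ¬ DifferentiableAt ℝ f w}
    rw [Measure.euclideanHausdorffMeasure_def, Measure.smul_apply] at hnull ⊢
    simp only [ENNReal.smul_def, smul_eq_mul, mul_eq_zero] at hnull ⊢
    rcases hnull with h | h
    · exact Or.inl h
    · rw [h, mul_zero] at hle
      exact Or.inr (le_antisymm hle bot_le)
  refine measure_mono_null ?_ hnull2
  rintro u ⟨⟨hu, x, hx, y, hy, hxy, hux, huy⟩, hpos⟩
  simp only [mem_ofPred_eq] at hpos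
  set t := ⟪e, u⟫ with ht
  have hwmem : t⁻¹ • u - e ∈ (ℝ ∙ e)ᗮ := by
    rw [Submodule.mem_orthogonal_singleton_iff_inner_right, inner_sub_right, inner_smul_right,
      real_inner_self_eq_norm_sq, he, ← ht]
    field_simp
    norm_num
  have hew : e + (t⁻¹ • u - e) = t⁻¹ • u := by abel
  refine ⟨⟨t⁻¹ • u - e, hwmem⟩, ?_, ?_⟩
  · intro hdiff
    have hmax : ∀ z : EuclideanSpace ℝ (Fin n), z ∈ K → ⟪u, z⟫ = supportFn K u →
        supportFn K (t⁻¹ • u) = ⟪t⁻¹ • u, z⟫ := by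
      intro z hz hzu
      refine le_antisymm ?_ (inner_le_supportFn K _ hz)
      obtain ⟨q, hq, h⟩ := exists_supportFn_eq K (t⁻¹ • u)
      rw [h, real_inner_smul_left, real_inner_smul_left, hzu]
      exact mul_le_mul_of_nonneg_left (inner_le_supportFn K u hq) (inv_nonneg.2 hpos.le)
    have hgrad : ∀ z : EuclideanSpace ℝ (Fin n), z ∈ K → ⟪u, z⟫ = supportFn K u →
        ∀ v : (ℝ ∙ e)ᗮ, fderiv ℝ f ⟨t⁻¹ • u - e, hwmem⟩ v =
          ⟪z, (v : EuclideanSpace ℝ (Fin n))⟫ := by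
      intro z hz hzu v
      let L : (ℝ ∙ e)ᗮ →L[ℝ] ℝ := (innerSL ℝ z).comp (ℝ ∙ e)ᗮ.subtypeL
      have hL : ∀ w, L w = ⟪z, (w : EuclideanSpace ℝ (Fin n))⟫ := fun w => rfl
      have hder : HasFDerivAt (fun w => f w - L w) (fderiv ℝ f ⟨t⁻¹ • u - e, hwmem⟩ - L)
          ⟨t⁻¹ • u - e, hwmem⟩ := hdiff.hasFDerivAt.sub L.hasFDerivAt
      have hmin : IsLocalMin (fun w => f w - L w) ⟨t⁻¹ • u - e, hwmem⟩ := by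
        refine Filter.Eventually.of_forall fun w => ?_
        have h1 := inner_le_supportFn K (e + (w : EuclideanSpace ℝ (Fin n))) hz
        have h2 := hmax z hz hzu
        simp only [f, hL, hew, h2]
        rw [inner_add_left, real_inner_comm z (w : EuclideanSpace ℝ (Fin n))] at h1
        rw [inner_sub_right, real_inner_comm (t⁻¹ • u) z, real_inner_comm e z]
        linarith
      have h0 := hmin.hasFDerivAt_eq_zero hder
      have := congrArg (fun T => T v) h0
      simp only [sub_apply, zero_apply, hL] at this
      linarith
    have horth : ∀ v ∈ (ℝ ∙ e)ᗮ, ⟪x - y, v⟫ = 0 := by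
      intro v hv
      have h1 := hgrad x hx hux ⟨v, hv⟩
      have h2 := hgrad y hy huy ⟨v, hv⟩
      rw [inner_sub_left, ← h1, ← h2, sub_self]
    have hu0 : ⟪x - y, t⁻¹ • u⟫ = 0 := by
      rw [inner_smul_right, inner_sub_left, real_inner_comm u x, real_inner_comm u y, hux, huy]
      simp
    have he1 : ⟪x - y, e⟫ = 0 := by
      have h := horth _ hwmem
      rw [inner_sub_right, hu0] at h
      linarith
    have hmem : x - y ∈ (ℝ ∙ e)ᗮ :=
      Submodule.mem_orthogonal_singleton_iff_inner_left.2 he1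
    exact hxy (sub_eq_zero.1 (inner_self_eq_zero.1 (horth _ hmem)))
  · simp only [hew, norm_smul, norm_inv, Real.norm_eq_abs, abs_of_pos hpos, hu, mul_one, inv_inv]
    rw [smul_smul, mul_inv_cancel₀ hpos.ne', one_smul]

/-- Almost every unit vector is an outer normal of `K` at exactly one point. -/
theorem null_singularNormals (K : ConvexBody (EuclideanSpace ℝ (Fin n))) :
    μHE[n - 1] (singularNormals K) = 0 := by
  let b : Fin n → EuclideanSpace ℝ (Fin n) := fun i => EuclideanSpace.single i 1
  have hb : ∀ i, ‖b i‖ = 1 := fun i => by simp [b]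
  have hsub : singularNormals K ⊆ ⋃ i : Fin n,
      ((singularNormals K ∩ {u | 0 < ⟪b i, u⟫}) ∪
        (singularNormals K ∩ {u | 0 < ⟪-(b i), u⟫})) := by
    intro u hu
    have hu0 : u ≠ 0 := by
      rintro rfl
      simpa using hu.1
    obtain ⟨i, hi⟩ : ∃ i, u i ≠ 0 := by
      by_contra! h
      exact hu0 (by ext i; simpa using h i)
    have hbi : ⟪b i, u⟫ = u i := by simp [b, EuclideanSpace.inner_single_left]
    refine mem_iUnion.2 ⟨i, ?_⟩
    rcases lt_or_gt_of_ne hi with h | h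
    · exact Or.inr ⟨hu, by rw [mem_ofPred_eq, inner_neg_left, hbi]; linarith⟩
    · exact Or.inl ⟨hu, by rw [mem_ofPred_eq, hbi]; exact h⟩
  refine measure_mono_null hsub (measure_iUnion_null fun i => measure_union_null ?_ ?_)
  · exact null_singularNormals_inter K _ (hb i)
  · exact null_singularNormals_inter K _ (by rw [norm_neg, hb i])

/-- The set function `β ↦ ℋⁿ⁻¹(ν(K, β))`, on all subsets. -/
def curvatureOuterMeasure (K : ConvexBody (EuclideanSpace ℝ (Fin n))) :
    OuterMeasure (EuclideanSpace ℝ (Fin n)) where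
  measureOf β := μHE[n - 1] (sphericalImage K β)
  empty := by simp [sphericalImage]
  mono h := measure_mono (sphericalImage_mono K h)
  iUnion_nat s _ := by
    refine (measure_mono ?_).trans (measure_iUnion_le _)
    rintro u ⟨hu, x, hx, hx'⟩
    obtain ⟨i, hi⟩ := mem_iUnion.1 hx
    exact mem_iUnion.2 ⟨i, hu, x, hi, hx'⟩

theorem isMetric_curvatureOuterMeasure (K : ConvexBody (EuclideanSpace ℝ (Fin n))) :
    (curvatureOuterMeasure K).IsMetric := by
  intro s t hst
  refine le_antisymm (measure_union_le s t) ?_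
  change μHE[n - 1] (sphericalImage K s) + μHE[n - 1] (sphericalImage K t) ≤
    μHE[n - 1] (sphericalImage K (s ∪ t))
  set A := sphericalImage K (closure s) with hA
  have hAm : MeasurableSet A := (isClosed_sphericalImage K isClosed_closure).measurableSet
  have hcap : sphericalImage K t ∩ A ⊆ singularNormals K := by
    rintro u ⟨⟨hu, x, hx, hxf, hxu⟩, -, y, hy, hyf, hyu⟩
    refine ⟨hu, x, K.isClosed.frontier_subset hxf, y, K.isClosed.frontier_subset hyf, ?_,
      by rw [real_inner_comm]; exact hxu, by rw [real_inner_comm]; exact hyu⟩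
    rintro rfl
    obtain ⟨r, hr0, hr⟩ := hst
    have h1 : Metric.infEDist x s = 0 := Metric.mem_closure_iff_infEDist_zero.1 hy
    have h2 : r ≤ Metric.infEDist x s := by
      refine Metric.le_infEDist.2 fun z hz => ?_
      rw [edist_comm]
      exact hr z hz x hx
    rw [h1] at h2
    exact hr0 (le_antisymm h2 bot_le)
  rw [sphericalImage_union,
    ← measure_inter_add_sdiff (sphericalImage K s ∪ sphericalImage K t) hAm]
  refine add_le_add (measure_mono ?_) ?_
  · exact fun u hu => ⟨Or.inl hu, sphericalImage_mono K subset_closure hu⟩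
  · calc μHE[n - 1] (sphericalImage K t)
        ≤ μHE[n - 1] (sphericalImage K t ∩ A) + μHE[n - 1] (sphericalImage K t \ A) :=
          measure_le_inter_add_sdiff _ _ _
      _ = μHE[n - 1] (sphericalImage K t \ A) := by
          rw [measure_mono_null hcap (null_singularNormals K), zero_add]
      _ ≤ _ := measure_mono (sdiff_subset_sdiff_left subset_union_right)

/-- The zeroth curvature measure `C₀(K, ·)`, the Borel measure with
`C₀(K, β) = ℋⁿ⁻¹(ν(K, β))`. It is regarded as a measure on `ℝⁿ` that is carried by `∂K`. -/
def curvatureMeasureZero (K : ConvexBody (EuclideanSpace ℝ (Fin n))) :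
    Measure (EuclideanSpace ℝ (Fin n)) :=
  (curvatureOuterMeasure K).toMeasure (isMetric_curvatureOuterMeasure K).le_caratheodory

theorem curvatureMeasureZero_apply (K : ConvexBody (EuclideanSpace ℝ (Fin n)))
    {β : Set (EuclideanSpace ℝ (Fin n))} (hβ : MeasurableSet β) :
    curvatureMeasureZero K β = μHE[n - 1] (sphericalImage K β) :=
  toMeasure_apply _ _ hβ

/-- The curvature measure `C_{n-1}(K, ·)`, the restriction of `ℋⁿ⁻¹` to `∂K`. Here `μHE[n - 1]`
is the Hausdorff measure normalized so as to agree with Lebesgue measure on `ℝⁿ⁻¹`. -/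
def curvatureMeasureTop (K : ConvexBody (EuclideanSpace ℝ (Fin n))) :
    Measure (EuclideanSpace ℝ (Fin n)) :=
  (μHE[n - 1]).restrict (frontier (K : Set (EuclideanSpace ℝ (Fin n))))

/-! ### The `L_p` affine surface area -/

/-- The positive continuous functions on `∂K`. -/
def positiveContinuous (K : ConvexBody (EuclideanSpace ℝ (Fin n))) :
    Set (EuclideanSpace ℝ (Fin n) → ℝ) :=
  {g | ContinuousOn g (frontier (K : Set (EuclideanSpace ℝ (Fin n)))) ∧
    ∀ x ∈ frontier (K : Set (EuclideanSpace ℝ (Fin n))), 0 < g x}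

/-- The `L_p` affine surface area: the infimum, over all positive continuous functions `g` on
`∂K`, of
`(∫_{∂K} g⁻ⁿ dC₀(K, ·)) ^ (p/(n+p)) * (∫_{∂K} gᵖ (h_K ∘ ν_K)¹⁻ᵖ dC_{n-1}(K, ·)) ^ (n/(n+p))`. -/
def affineSurfaceArea (p : ℝ) (K : ConvexBody (EuclideanSpace ℝ (Fin n))) : ℝ≥0∞ :=
  ⨅ g ∈ positiveContinuous K,
    (∫⁻ x in frontier (K : Set (EuclideanSpace ℝ (Fin n))),
        ENNReal.ofReal ((g x ^ n)⁻¹) ∂(curvatureMeasureZero K)) ^ (p / (n + p)) *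
    (∫⁻ x in frontier (K : Set (EuclideanSpace ℝ (Fin n))),
        ENNReal.ofReal (g x ^ p * supportFn K (gaussMap K x) ^ (1 - p))
          ∂(curvatureMeasureTop K)) ^ ((n : ℝ) / (n + p))

/-- The image `φK` of a convex body under a linear map. -/
def linearImage (φ : EuclideanSpace ℝ (Fin n) →ₗ[ℝ] EuclideanSpace ℝ (Fin n))
    (K : ConvexBody (EuclideanSpace ℝ (Fin n))) : ConvexBody (EuclideanSpace ℝ (Fin n)) where
  carrier := φ '' (K : Set (EuclideanSpace ℝ (Fin n)))
  convex' := K.convex.linear_image φ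
  isCompact' := K.isCompact.image φ.continuous_of_finiteDimensional
  nonempty' := K.nonempty.image φ

end LpAffine

end

/-!
The affine surface area only depends on how the curvature measures `C₀` and `C_{n-1}` behave on the
set of regular boundary points, and there both transform under a linear map `φ` by explicit
densities. Let `A` be the inverse transpose of `φ` and let `w x = ‖A (ν_K x)‖` at a regular point
`x`. The normal of `φK` at `φ x` is `A (ν_K x) / w x`, the support function there is
`h_K (ν_K x) / w x`, and

* `C_{n-1}` of `φK`, pulled back by `φ`, has density `|det φ| * w` with respect to `C_{n-1}` of `K`
  (`euclideanHausdorffMeasure_image_regular`);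
* `C₀` of `φK`, pulled back by `φ`, has density `|det φ|⁻¹ * w ^ (-n)` with respect to `C₀` of `K`
  (`curvatureMeasureZero_linearImage`).

Therefore replacing `g` by `g / w` leaves the two integrals unchanged up to the factors `|det φ|⁻¹`
and `|det φ|`, whose weighted product is `|det φ| ^ ((n - p) / (n + p))`.

The function `g / w` is not continuous and is undefined at nonregular points, where `C₀` may well
have mass. Two facts repair this. By density of continuous functions in `L¹`, the infimum may be
tested on Borel functions bounded away from `0` and `∞` (`affineSurfaceArea_le_of_measurable`).
And nonregular points form a null set for `C_{n-1}`, so the test function may be given a huge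
constant value there, which makes their share of the first integral arbitrarily small. The null set
statement follows by polarity (`euclideanHausdorffMeasure_frontier_diff_regular`): two normals at a
boundary point of `K` are two contact points of the polar body with a common normal, and this
happens for almost no direction. The resulting inequality (`affineSurfaceArea_linearImage_le`),
applied to `φ` and to its inverse, is the equality.

Both densities come from one local estimate
(`exists_euclideanHausdorffMeasure_image_comparison`) for maps that are nearly linear along chords
nearly orthogonal to a fixed vector, made global by `measure_eq_setLIntegral_of_local`. For `∂K` the
condition on chords is provided by convexity: a chord between two boundary points is almost
orthogonal to the normals at its endpoints as soon as these are close to each other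
(`abs_inner_sub_le`).
-/

namespace LpAffine

open Filter Topology

/-! ### Hausdorff measure of nearly linear images -/

theorem euclideanHausdorffMeasure_image_le_of_lipschitzOnWith {X Y : Type*} [EMetricSpace X]
    [MeasurableSpace X] [BorelSpace X] [EMetricSpace Y] [MeasurableSpace Y] [BorelSpace Y]
    (d : ℕ) {C : ℝ≥0} {f : X → Y} {s : Set X} (h : LipschitzOnWith C f s) :
    μHE[d] (f '' s) ≤ (C : ℝ≥0∞) ^ d * μHE[d] s := by
  have h1 := h.hausdorffMeasure_image_le (d := (d : ℝ)) (by positivity)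
  rw [ENNReal.rpow_natCast] at h1
  simp only [Measure.euclideanHausdorffMeasure_def, Measure.smul_apply, ENNReal.smul_def,
    smul_eq_mul]
  calc _ ≤ _ * ((C : ℝ≥0∞) ^ d * μH[d] s) := by gcongr
    _ = _ := by ring

/-- If distances between values of `f` on `s` are at most `C` times those between values of `g`,
then `f '' s` is a `C`-Lipschitz image of `g '' s`. Neither map has to be injective. -/
theorem euclideanHausdorffMeasure_image_le_of_dist_le {X Y Z : Type*} [MetricSpace Y]
    [MeasurableSpace Y] [BorelSpace Y] [MetricSpace Z] [MeasurableSpace Z] [BorelSpace Z]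
    (d : ℕ) {C : ℝ} (hC : 0 ≤ C) {f : X → Y} {g : X → Z} {s : Set X}
    (h : ∀ x ∈ s, ∀ y ∈ s, dist (f x) (f y) ≤ C * dist (g x) (g y)) :
    μHE[d] (f '' s) ≤ ENNReal.ofReal (C ^ d) * μHE[d] (g '' s) := by
  rcases s.eq_empty_or_nonempty with rfl | ⟨x₀, -⟩
  · simp
  have : Nonempty X := ⟨x₀⟩
  set k := Function.invFunOn g s with hk
  have hmem : ∀ z ∈ g '' s, k z ∈ s ∧ g (k z) = z := fun z hz =>
    ⟨Function.invFunOn_mem hz, Function.invFunOn_eq hz⟩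
  have hL : LipschitzOnWith C.toNNReal (f ∘ k) (g '' s) := by
    refine LipschitzOnWith.of_dist_le_mul fun a ha b hb => ?_
    rw [Real.coe_toNNReal _ hC]
    have := h _ (hmem a ha).1 _ (hmem b hb).1
    rwa [(hmem a ha).2, (hmem b hb).2] at this
  have himg : f '' s = (f ∘ k) '' (g '' s) := by
    rw [image_image]
    refine image_congr fun x hx => ?_
    have hx' := hmem (g x) (mem_image_of_mem g hx)
    have := h x hx _ hx'.1
    rw [hx'.2, dist_self, mul_zero] at this
    exact dist_le_zero.1 this
  rw [himg, ENNReal.ofReal_pow hC]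
  exact euclideanHausdorffMeasure_image_le_of_lipschitzOnWith d hL

/-- A density can be recognised locally: it suffices that near each point `x` of `M`, for each
`δ > 1`, the measures `ν` and `G x • μ` agree up to the factor `δ`. By the Lindelöf property `β`
is cut into countably many pieces on which `ν` and `G • μ` agree up to `δ ^ 2`; then `δ → 1`. -/
theorem measure_eq_setLIntegral_of_local {X : Type*} [TopologicalSpace X]
    [SecondCountableTopology X] [MeasurableSpace X] [OpensMeasurableSpace X] (μ ν : Measure X)
    {M : Set X} {G : X → ℝ≥0∞} (hG : ContinuousOn G M) (hG0 : ∀ x ∈ M, G x ≠ 0)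
    (hGt : ∀ x ∈ M, G x ≠ ⊤)
    (h : ∀ x ∈ M, ∀ δ : ℝ, 1 < δ → ∃ U ∈ 𝓝[M] x, ∀ β ⊆ U ∩ M, MeasurableSet β →
      ν β ≤ ENNReal.ofReal δ * (G x * μ β) ∧ G x * μ β ≤ ENNReal.ofReal δ * ν β)
    {β : Set X} (hβM : β ⊆ M) (hβ : MeasurableSet β) : ν β = ∫⁻ x in β, G x ∂μ := by
  have key : ∀ δ : ℝ, 1 < δ → ν β ≤ ENNReal.ofReal (δ ^ 2) * ∫⁻ x in β, G x ∂μ ∧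
      ∫⁻ x in β, G x ∂μ ≤ ENNReal.ofReal (δ ^ 2) * ν β := by
    intro δ hδ
    have hδ0 : 0 ≤ δ := by linarith
    have hδ1 : 1 < ENNReal.ofReal δ := by simpa using hδ
    have hloc : ∀ x ∈ M, ∃ O, IsOpen O ∧ x ∈ O ∧ ∀ β ⊆ O ∩ M, MeasurableSet β →
        ν β ≤ ENNReal.ofReal (δ ^ 2) * ∫⁻ x in β, G x ∂μ ∧
        ∫⁻ x in β, G x ∂μ ≤ ENNReal.ofReal (δ ^ 2) * ν β := by
      intro x hx
      obtain ⟨U, hU, hUβ⟩ := h x hx δ hδ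
      have h1 : ∀ᶠ y in 𝓝[M] x, G y < ENNReal.ofReal δ * G x :=
        (hG x hx).eventually_lt_const (by
          conv_lhs => rw [← one_mul (G x)]
          exact ENNReal.mul_lt_mul_left (hG0 x hx) (hGt x hx) hδ1)
      have h2 : ∀ᶠ y in 𝓝[M] x, (ENNReal.ofReal δ)⁻¹ * G x < G y :=
        (hG x hx).eventually_const_lt (by
          conv_rhs => rw [← one_mul (G x)]
          exact ENNReal.mul_lt_mul_left (hG0 x hx) (hGt x hx) (ENNReal.inv_lt_one.2 hδ1))
      obtain ⟨O, hO, hxO, hOs⟩ := mem_nhdsWithin.1 (inter_mem hU (h1.and h2))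
      refine ⟨O, hO, hxO, fun γ hγ hγm => ?_⟩
      have hγU : γ ⊆ U ∩ M := fun y hy => ⟨(hOs (hγ hy)).1, (hγ hy).2⟩
      obtain ⟨h3, h4⟩ := hUβ γ hγU hγm
      rw [ENNReal.ofReal_pow hδ0, pow_two, mul_assoc, mul_assoc]
      constructor
      · refine h3.trans (mul_le_mul' le_rfl ?_)
        rw [← setLIntegral_const, ← lintegral_const_mul' _ _ ENNReal.ofReal_ne_top]
        refine setLIntegral_mono' hγm fun y hy => ?_
        have := (hOs (hγ hy)).2.2.le
        calc G x = ENNReal.ofReal δ * ((ENNReal.ofReal δ)⁻¹ * G x) := by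
              rw [← mul_assoc, ENNReal.mul_inv_cancel (by positivity) ENNReal.ofReal_ne_top,
                one_mul]
          _ ≤ _ := by gcongr
      · calc ∫⁻ y in γ, G y ∂μ ≤ ∫⁻ y in γ, ENNReal.ofReal δ * G x ∂μ :=
              setLIntegral_mono' hγm fun y hy => (hOs (hγ hy)).2.1.le
          _ = ENNReal.ofReal δ * (G x * μ γ) := by rw [setLIntegral_const, mul_assoc]
          _ ≤ _ := by gcongr
    choose! O hO hxO hOβ using hloc
    obtain ⟨t, htM, htc, hcov⟩ := TopologicalSpace.countable_cover_nhdsWithin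
      (f := O) (s := M) fun x hx => mem_nhdsWithin_of_mem_nhds ((hO x hx).mem_nhds (hxO x hx))
    rcases t.eq_empty_or_nonempty with rfl | hne
    · have : β = ∅ := by
        apply subset_empty_iff.1
        simpa using hβM.trans hcov
      simp [this]
    obtain ⟨e, rfl⟩ := htc.exists_eq_range hne
    have heM : ∀ i, e i ∈ M := fun i => htM (mem_range_self i)
    set D := disjointed (fun i => O (e i)) with hD
    have hDm : ∀ i, MeasurableSet (D i) :=
      fun i => MeasurableSet.disjointed (fun i => (hO _ (heM i)).measurableSet) i
    have hUn : β = ⋃ i, β ∩ D i := by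
      rw [← inter_iUnion, iUnion_disjointed, inter_eq_left.2]
      simpa using hβM.trans hcov
    have hdisj : Pairwise (Function.onFun Disjoint fun i => β ∩ D i) := fun i j hij =>
      (disjoint_disjointed (fun i => O (e i)) hij).mono inter_subset_right inter_subset_right
    have hm : ∀ i, MeasurableSet (β ∩ D i) := fun i => hβ.inter (hDm i)
    have hpiece : ∀ i, _ := fun i => hOβ (e i) (heM i) (β ∩ D i)
      (fun y hy => ⟨disjointed_subset _ i hy.2, hβM hy.1⟩) (hm i)
    have e1 : ν β = ∑' i, ν (β ∩ D i) := by
      conv_lhs => rw [hUn]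
      exact measure_iUnion hdisj hm
    have e2 : ∫⁻ x in β, G x ∂μ = ∑' i, ∫⁻ x in β ∩ D i, G x ∂μ := by
      conv_lhs => rw [hUn]
      exact lintegral_iUnion hm hdisj G
    rw [e1, e2, ← ENNReal.tsum_mul_left, ← ENNReal.tsum_mul_left]
    exact ⟨ENNReal.tsum_le_tsum fun i => (hpiece i).1, ENNReal.tsum_le_tsum fun i => (hpiece i).2⟩
  have hlim : ∀ c : ℝ≥0∞, Tendsto (fun δ : ℝ => ENNReal.ofReal (δ ^ 2) * c) (𝓝[>] 1) (𝓝 c) := by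
    intro c
    have h1 : Tendsto (fun δ : ℝ => ENNReal.ofReal (δ ^ 2)) (𝓝[>] 1) (𝓝 1) := by
      have : Continuous fun δ : ℝ => ENNReal.ofReal (δ ^ 2) :=
        ENNReal.continuous_ofReal.comp (by fun_prop)
      simpa using (this.tendsto 1).mono_left nhdsWithin_le_nhds
    simpa using ENNReal.Tendsto.mul_const (b := c) h1 (Or.inl one_ne_zero)
  exact le_antisymm
    (ge_of_tendsto (hlim _) (eventually_nhdsWithin_of_forall fun δ hδ => (key δ hδ).1))
    (ge_of_tendsto (hlim _) (eventually_nhdsWithin_of_forall fun δ hδ => (key δ hδ).2))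

variable {n : ℕ}

theorem finrank_orthogonal_span_of_norm_eq_one {u : EuclideanSpace ℝ (Fin n)} (hu : ‖u‖ = 1) :
    Module.finrank ℝ (ℝ ∙ u)ᗮ = n - 1 := by
  have hu0 : u ≠ 0 := by rintro rfl; simp at hu
  have := Submodule.finrank_add_finrank_orthogonal (ℝ ∙ u)
  rw [finrank_span_singleton hu0, finrank_euclideanSpace_fin] at this
  omega

/-- A linear map that sends the unit vector `u` to the unit vector `v` and `uᗮ` into `vᗮ` scales the
`(n - 1)`-dimensional measure on `uᗮ` by the absolute value of its full determinant. -/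
theorem euclideanHausdorffMeasure_image_of_subset_orthogonal
    {T : EuclideanSpace ℝ (Fin n) →ₗ[ℝ] EuclideanSpace ℝ (Fin n)}
    {u v : EuclideanSpace ℝ (Fin n)} (hu : ‖u‖ = 1) (hv : ‖v‖ = 1) (hTu : T u = v)
    (hT : ∀ w, ⟪u, w⟫ = 0 → ⟪v, T w⟫ = 0) {s : Set (EuclideanSpace ℝ (Fin n))}
    (hs : ∀ w ∈ s, ⟪u, w⟫ = 0) :
    μHE[n - 1] (T '' s) = ENNReal.ofReal |LinearMap.det T| * μHE[n - 1] s := by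
  -- After composition with a reflection that sends `v` to `u`, the map preserves both `uᗮ` and `u`,
  -- so its determinant is that of its restriction to `uᗮ`.
  set R : EuclideanSpace ℝ (Fin n) ≃ₗᵢ[ℝ] EuclideanSpace ℝ (Fin n) :=
    (ℝ ∙ (v - u))ᗮ.reflection with hR
  have hRv : R v = u := Submodule.reflection_sub (by rw [hu, hv])
  set W := (ℝ ∙ u)ᗮ with hW
  have hWmem : ∀ w, w ∈ W ↔ ⟪u, w⟫ = 0 := fun w =>
    Submodule.mem_orthogonal_singleton_iff_inner_right
  set S : EuclideanSpace ℝ (Fin n) →ₗ[ℝ] EuclideanSpace ℝ (Fin n) :=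
    R.toLinearEquiv.toLinearMap ∘ₗ T with hS
  have hSa : ∀ w, S w = R (T w) := fun w => rfl
  have hSW : W ≤ W.comap S := by
    intro w hw
    rw [Submodule.mem_comap, hWmem, hSa, ← hRv, R.inner_map_map]
    exact hT w ((hWmem w).1 hw)
  have hmapQ : W.mapQ W S hSW = LinearMap.id := by
    refine Submodule.linearMap_qext _ (LinearMap.ext fun x => ?_)
    simp only [LinearMap.comp_apply, Submodule.mkQ_apply, Submodule.mapQ_apply, LinearMap.id_apply]
    rw [Submodule.Quotient.eq]
    have hx : x = (x - ⟪u, x⟫ • u) + ⟪u, x⟫ • u := by abel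
    have h1 : x - ⟪u, x⟫ • u ∈ W := by
      rw [hWmem, inner_sub_right, inner_smul_right, real_inner_self_eq_norm_sq, hu]; ring
    have h2 : S x - x = S (x - ⟪u, x⟫ • u) - (x - ⟪u, x⟫ • u) := by
      have : S u = u := by rw [hSa, hTu, hRv]
      rw [map_sub, map_smul, this]; abel
    rw [h2]
    exact W.sub_mem (hSW h1) h1
  have hdet : |LinearMap.det (S.restrict hSW)| = |LinearMap.det T| := by
    have h1 := LinearMap.det_eq_det_mul_det W S hSW
    rw [hmapQ, LinearMap.det_id, mul_one] at h1
    rw [← h1, hS, LinearMap.det_comp, abs_mul]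
    have : |LinearMap.det R.toLinearEquiv.toLinearMap| = 1 := by
      rw [← LinearMap.normDet_eq_abs_det]
      exact R.toLinearIsometry.normDet_eq_one
    rw [this, one_mul]
  set s' : Set W := (↑) ⁻¹' s with hs'
  have hss : (↑) '' s' = s := by
    refine (image_preimage_eq_inter_range).trans (inter_eq_left.2 fun w hw => ?_)
    exact ⟨⟨w, (hWmem w).2 (hs w hw)⟩, rfl⟩
  have e1 : μHE[n - 1] (T '' s) = μHE[n - 1] (S '' s) := by
    rw [← R.isometry.euclideanHausdorffMeasure_image, image_image]
    rfl
  have e2 : S '' s = (↑) '' (S.restrict (p := W) (q := W) hSW '' s') := by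
    rw [← hss, image_image, image_image]
    rfl
  have e3 : μHE[n - 1] s = μHE[n - 1] s' := by
    conv_lhs => rw [← hss]
    exact isometry_subtype_coe.euclideanHausdorffMeasure_image s'
  rw [e1, e2, isometry_subtype_coe.euclideanHausdorffMeasure_image, e3,
    ← finrank_orthogonal_span_of_norm_eq_one hu, LinearMap.euclideanHausdorffMeasure_image,
    LinearMap.normDet_eq_abs_det, hdet]

/-- The local step of the area formula. If the chords of `β` are almost orthogonal to `u` and `f` is
close to `T` on these chords, then `f` scales the `(n - 1)`-dimensional measure of `β` almost by
`|det T|`: the projection `P` of `β` to `uᗮ`, and the map from `T '' (P '' β)` to `f '' β`, are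
bi-Lipschitz with constants near `1`. -/
theorem exists_euclideanHausdorffMeasure_image_comparison
    {T : EuclideanSpace ℝ (Fin n) →ₗ[ℝ] EuclideanSpace ℝ (Fin n)} (hdet : LinearMap.det T ≠ 0)
    {u v : EuclideanSpace ℝ (Fin n)} (hu : ‖u‖ = 1) (hv : ‖v‖ = 1) (hTu : T u = v)
    (hT : ∀ w, ⟪u, w⟫ = 0 → ⟪v, T w⟫ = 0) {δ : ℝ} (hδ : 1 < δ) :
    ∃ ε > 0, ∀ (f : EuclideanSpace ℝ (Fin n) → EuclideanSpace ℝ (Fin n))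
      (β : Set (EuclideanSpace ℝ (Fin n))),
      (∀ y ∈ β, ∀ z ∈ β, |⟪u, y - z⟫| ≤ ε * ‖y - z‖) →
      (∀ y ∈ β, ∀ z ∈ β, ‖f y - f z - T (y - z)‖ ≤ ε * ‖y - z‖) →
      μHE[n - 1] (f '' β) ≤
        ENNReal.ofReal δ * (ENNReal.ofReal |LinearMap.det T| * μHE[n - 1] β) ∧
      ENNReal.ofReal |LinearMap.det T| * μHE[n - 1] β ≤ ENNReal.ofReal δ * μHE[n - 1] (f '' β) := by
  obtain ⟨k, hkδ, hk⟩ : ∃ k : ℝ, k ^ (2 * (n - 1)) < δ ∧ 1 < k := by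
    have hc : ContinuousAt (fun k : ℝ => k ^ (2 * (n - 1))) 1 := by fun_prop
    have := (hc.mono_left (nhdsWithin_le_nhds (s := Ioi 1))).eventually_lt_const
      (u := δ) (by simpa using hδ)
    exact (this.and self_mem_nhdsWithin).exists
  have hk0 : 0 < k := by linarith
  obtain ⟨m, hm, hmT⟩ : ∃ m > 0, ∀ w, m * ‖w‖ ≤ ‖T w‖ := by
    have hker : LinearMap.ker T = ⊥ :=
      LinearMap.ker_eq_bot.2 (LinearEquiv.ofIsUnitDet (f := T)
        (v := (EuclideanSpace.basisFun (Fin n) ℝ).toBasis)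
        (v' := (EuclideanSpace.basisFun (Fin n) ℝ).toBasis) (by
          rw [LinearMap.det_toMatrix]; exact hdet.isUnit)).injective
    obtain ⟨C, hC, hCT⟩ := T.exists_antilipschitzWith hker
    refine ⟨(C : ℝ)⁻¹, by positivity, fun w => ?_⟩
    have := hCT.le_mul_dist w 0
    rw [map_zero, dist_zero_right, dist_zero_right] at this
    rw [inv_mul_le_iff₀ (by positivity)]
    exact this
  have hki : 0 < 1 - 1 / k := by
    rw [sub_pos, div_lt_one hk0]; exact hk
  -- With `w = y - z`: `‖f y - f z - T (P w)‖ ≤ 2 * ε * ‖w‖ ≤ (4 * ε / m) * ‖T (P w)‖`, as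
  -- `‖T (P w)‖ ≥ m * (1 - ε) * ‖w‖`; the third bound makes the factor at most `1 - 1 / k`.
  set ε := min (1 / 2) (min (1 - 1 / k) ((1 - 1 / k) * m / 4)) with hε
  have hε0 : 0 < ε := by positivity
  have hε1 : ε ≤ 1 / 2 := min_le_left _ _
  have hε2 : ε ≤ 1 - 1 / k := (min_le_right _ _).trans (min_le_left _ _)
  have hε3 : ε ≤ (1 - 1 / k) * m / 4 := (min_le_right _ _).trans (min_le_right _ _)
  refine ⟨ε, hε0, fun f β hchord hf => ?_⟩
  set P : EuclideanSpace ℝ (Fin n) → EuclideanSpace ℝ (Fin n) := fun w => w - ⟪u, w⟫ • u with hP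
  have hPsub : ∀ y z, P y - P z = P (y - z) := fun y z => by
    simp only [hP, inner_sub_right, sub_smul]; abel
  have hPo : ∀ w, ⟪u, P w⟫ = 0 := fun w => by
    simp only [hP]
    rw [inner_sub_right, inner_smul_right, real_inner_self_eq_norm_sq, hu]; ring
  have hPle : ∀ w, ‖P w‖ ≤ ‖w‖ := fun w => by
    have : ‖w‖ ^ 2 = ‖P w‖ ^ 2 + ⟪u, w⟫ ^ 2 := by
      have h1 : w = P w + ⟪u, w⟫ • u := by simp [hP]
      conv_lhs => rw [h1]
      rw [norm_add_sq_real, inner_smul_right, real_inner_comm u (P w), hPo, norm_smul, hu]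
      simp
    nlinarith [norm_nonneg w, norm_nonneg (P w), sq_nonneg ⟪u, w⟫,
      abs_le_of_sq_le_sq' (a := ‖P w‖) (b := ‖w‖) (by nlinarith [sq_nonneg ⟪u, w⟫]) (norm_nonneg w)]
  have hkε : k * (1 - ε) ≥ 1 := by
    have : k * (1 - 1 / k) = k - 1 := by field_simp
    nlinarith
  have hk2 : 1 + (1 - 1 / k) ≤ k := by
    have : k * (1 / k) = 1 := by field_simp
    nlinarith [sq_nonneg (k - 1), this, mul_self_nonneg (k - 1)]
  have hk3 : k * (1 - (1 - 1 / k)) = 1 := by field_simp; ring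
  have hPge : ∀ y ∈ β, ∀ z ∈ β, (1 - ε) * ‖y - z‖ ≤ ‖P (y - z)‖ := by
    intro y hy z hz
    have h1 : ‖y - z‖ ≤ ‖P (y - z)‖ + ‖⟪u, y - z⟫ • u‖ := by
      conv_lhs => rw [show y - z = P (y - z) + ⟪u, y - z⟫ • u by simp [hP]]
      exact norm_add_le _ _
    rw [norm_smul, hu, mul_one, Real.norm_eq_abs] at h1
    linarith [hchord y hy z hz]
  have hdiff : ∀ y ∈ β, ∀ z ∈ β,
      ‖f y - f z - T (P (y - z))‖ ≤ (1 - 1 / k) * ‖T (P (y - z))‖ := by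
    intro y hy z hz
    have h1 : f y - f z - T (P (y - z)) = (f y - f z - T (y - z)) + ⟪u, y - z⟫ • v := by
      simp only [hP, map_sub, map_smul, hTu]; abel
    have h2 : ‖f y - f z - T (P (y - z))‖ ≤ 2 * ε * ‖y - z‖ := by
      rw [h1]
      refine (norm_add_le _ _).trans ?_
      rw [norm_smul, hv, mul_one, Real.norm_eq_abs]
      linarith [hf y hy z hz, hchord y hy z hz]
    have h3 := hmT (P (y - z))
    have h4 := hPge y hy z hz
    have h5 : m * ‖y - z‖ ≤ 2 * ‖T (P (y - z))‖ := by
      nlinarith [norm_nonneg (y - z), mul_le_mul_of_nonneg_left h4 hm.le,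
        mul_nonneg hm.le (norm_nonneg (y - z))]
    calc _ ≤ 2 * ε * ‖y - z‖ := h2
      _ ≤ 2 * ((1 - 1 / k) * m / 4) * ‖y - z‖ := by gcongr
      _ = (1 - 1 / k) / 2 * (m * ‖y - z‖) := by ring
      _ ≤ (1 - 1 / k) / 2 * (2 * ‖T (P (y - z))‖) := by gcongr
      _ = _ := by ring
  have c1 : μHE[n - 1] (f '' β) ≤
      ENNReal.ofReal (k ^ (n - 1)) * μHE[n - 1] ((fun w => T (P w)) '' β) := by
    refine euclideanHausdorffMeasure_image_le_of_dist_le _ hk0.le fun y hy z hz => ?_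
    rw [dist_eq_norm, dist_eq_norm, ← map_sub, hPsub]
    have := norm_sub_norm_le (f y - f z) (T (P (y - z)))
    nlinarith [hdiff y hy z hz, norm_nonneg (T (P (y - z)))]
  have c2 : μHE[n - 1] ((fun w => T (P w)) '' β) ≤
      ENNReal.ofReal (k ^ (n - 1)) * μHE[n - 1] (f '' β) := by
    refine euclideanHausdorffMeasure_image_le_of_dist_le _ hk0.le fun y hy z hz => ?_
    rw [dist_eq_norm, dist_eq_norm, ← map_sub, hPsub]
    have h1 := norm_sub_norm_le (T (P (y - z))) (f y - f z)
    rw [norm_sub_rev (T (P (y - z))) (f y - f z)] at h1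
    have h2 : k⁻¹ * ‖T (P (y - z))‖ ≤ ‖f y - f z‖ := by
      rw [← one_div]; linarith [hdiff y hy z hz]
    rwa [inv_mul_le_iff₀ hk0] at h2
  have c3 : μHE[n - 1] β ≤ ENNReal.ofReal (k ^ (n - 1)) * μHE[n - 1] (P '' β) := by
    have := euclideanHausdorffMeasure_image_le_of_dist_le (n - 1) hk0.le
      (f := id) (g := P) (s := β) fun y hy z hz => by
        rw [id, id, dist_eq_norm, dist_eq_norm, hPsub]
        have h4 := hPge y hy z hz
        nlinarith [norm_nonneg (y - z), mul_le_mul_of_nonneg_left h4 hk0.le]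
    simpa using this
  have c4 : μHE[n - 1] (P '' β) ≤ μHE[n - 1] β := by
    have := euclideanHausdorffMeasure_image_le_of_dist_le (n - 1) zero_le_one
      (f := P) (g := id) (s := β) fun y hy z hz => by
        rw [id, id, dist_eq_norm, dist_eq_norm, hPsub, one_mul]
        exact hPle _
    simpa using this
  have c5 : μHE[n - 1] ((fun w => T (P w)) '' β) =
      ENNReal.ofReal |LinearMap.det T| * μHE[n - 1] (P '' β) := by
    rw [← image_image T P]
    refine euclideanHausdorffMeasure_image_of_subset_orthogonal hu hv hTu hT ?_
    rintro _ ⟨w, -, rfl⟩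
    exact hPo w
  have hkle : ENNReal.ofReal (k ^ (n - 1)) * ENNReal.ofReal (k ^ (n - 1)) ≤ ENNReal.ofReal δ := by
    rw [← ENNReal.ofReal_mul (by positivity), ← pow_add, ← two_mul]
    exact ENNReal.ofReal_le_ofReal hkδ.le
  have hkle' : ENNReal.ofReal (k ^ (n - 1)) ≤ ENNReal.ofReal δ := by
    refine ENNReal.ofReal_le_ofReal (le_trans ?_ hkδ.le)
    exact pow_le_pow_right₀ hk.le (by omega)
  constructor
  · calc _ ≤ _ := c1
      _ ≤ _ := by rw [c5]; gcongr
  · calc ENNReal.ofReal |LinearMap.det T| * μHE[n - 1] β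
        ≤ ENNReal.ofReal |LinearMap.det T| *
          (ENNReal.ofReal (k ^ (n - 1)) * μHE[n - 1] (P '' β)) := by gcongr
      _ = ENNReal.ofReal (k ^ (n - 1)) * μHE[n - 1] ((fun w => T (P w)) '' β) := by rw [c5]; ring
      _ ≤ ENNReal.ofReal (k ^ (n - 1)) *
          (ENNReal.ofReal (k ^ (n - 1)) * μHE[n - 1] (f '' β)) := by gcongr
      _ ≤ _ := by rw [← mul_assoc]; gcongr

/-! ### Outer unit normals and the support function -/

theorem mem_sphericalImage_singleton {K : ConvexBody (EuclideanSpace ℝ (Fin n))}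
    {x u : EuclideanSpace ℝ (Fin n)} :
    u ∈ sphericalImage K {x} ↔
      ‖u‖ = 1 ∧ x ∈ frontier (K : Set (EuclideanSpace ℝ (Fin n))) ∧ ⟪x, u⟫ = supportFn K u := by
  simp [sphericalImage]

theorem norm_gaussMap {K : ConvexBody (EuclideanSpace ℝ (Fin n))}
    {x : EuclideanSpace ℝ (Fin n)} (hx : IsRegularPoint K x) : ‖gaussMap K x‖ = 1 :=
  (gaussMap_mem K hx).1

theorem eq_gaussMap {K : ConvexBody (EuclideanSpace ℝ (Fin n))}
    {x u : EuclideanSpace ℝ (Fin n)} (hx : IsRegularPoint K x) (hu : u ∈ sphericalImage K {x}) :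
    u = gaussMap K x :=
  hx.2.unique hu (gaussMap_mem K hx)

theorem sphericalImage_eq_gaussMap_image {K : ConvexBody (EuclideanSpace ℝ (Fin n))}
    {β : Set (EuclideanSpace ℝ (Fin n))} (hβ : β ⊆ {x | IsRegularPoint K x}) :
    sphericalImage K β = gaussMap K '' β := by
  ext u
  constructor
  · rintro ⟨hu, x, hx, hxf, hxu⟩
    exact ⟨x, hx, (eq_gaussMap (hβ hx) (mem_sphericalImage_singleton.2 ⟨hu, hxf, hxu⟩)).symm⟩
  · rintro ⟨x, hx, rfl⟩
    exact sphericalImage_mono K (singleton_subset_iff.2 hx) (gaussMap_mem K (hβ hx))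

theorem supportFn_smul (K : ConvexBody (EuclideanSpace ℝ (Fin n)))
    {c : ℝ} (hc : 0 ≤ c) (u : EuclideanSpace ℝ (Fin n)) :
    supportFn K (c • u) = c * supportFn K u := by
  refine le_antisymm ?_ ?_
  · obtain ⟨y, hy, h⟩ := exists_supportFn_eq K (c • u)
    rw [h, real_inner_smul_left]
    exact mul_le_mul_of_nonneg_left (inner_le_supportFn K u hy) hc
  · obtain ⟨y, hy, h⟩ := exists_supportFn_eq K u
    rw [h, ← real_inner_smul_left]
    exact inner_le_supportFn K _ hy

theorem exists_le_supportFn {K : ConvexBody (EuclideanSpace ℝ (Fin n))}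
    (hK : (0 : EuclideanSpace ℝ (Fin n)) ∈ interior (K : Set (EuclideanSpace ℝ (Fin n)))) :
    ∃ r > 0, ∀ u, r * ‖u‖ ≤ supportFn K u := by
  obtain ⟨r, hr, hrK⟩ := Metric.nhds_basis_closedBall.mem_iff.1 (mem_interior_iff_mem_nhds.1 hK)
  refine ⟨r, hr, fun u => ?_⟩
  rcases eq_or_ne u 0 with rfl | hu
  · simpa using inner_le_supportFn K 0 (interior_subset hK)
  have hu' : 0 < ‖u‖ := norm_pos_iff.2 hu
  have hmem : (r * ‖u‖⁻¹) • u ∈ K := by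
    apply hrK
    rw [mem_closedBall_zero_iff, norm_smul, Real.norm_of_nonneg (by positivity)]
    field_simp
    exact le_rfl
  have := inner_le_supportFn K u hmem
  rw [inner_smul_right, real_inner_self_eq_norm_sq] at this
  calc r * ‖u‖ = r * ‖u‖⁻¹ * ‖u‖ ^ 2 := by field_simp
    _ ≤ _ := this

theorem exists_supportFn_le (K : ConvexBody (EuclideanSpace ℝ (Fin n))) :
    ∃ R > 0, ∀ u, supportFn K u ≤ R * ‖u‖ := by
  obtain ⟨R, hR⟩ := K.isCompact.isBounded.exists_norm_le
  refine ⟨max R 1, by positivity, fun u => ?_⟩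
  obtain ⟨y, hy, h⟩ := exists_supportFn_eq K u
  rw [h, mul_comm]
  exact (real_inner_le_norm _ _).trans
    (mul_le_mul_of_nonneg_left ((hR y hy).trans (le_max_left _ _)) (norm_nonneg _))

theorem sphericalImage_singleton_nonempty {K : ConvexBody (EuclideanSpace ℝ (Fin n))}
    (hK : (0 : EuclideanSpace ℝ (Fin n)) ∈ interior (K : Set (EuclideanSpace ℝ (Fin n))))
    {x : EuclideanSpace ℝ (Fin n)}
    (hx : x ∈ frontier (K : Set (EuclideanSpace ℝ (Fin n)))) :
    (sphericalImage K {x}).Nonempty := by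
  obtain ⟨f, hf⟩ := geometric_hahn_banach_open_point K.convex.interior isOpen_interior hx.2
  obtain ⟨v, rfl⟩ := (InnerProductSpace.toDual ℝ (EuclideanSpace ℝ (Fin n))).surjective f
  simp only [InnerProductSpace.toDual_apply_apply] at hf
  have hv : v ≠ 0 := by
    rintro rfl
    simpa using hf 0 hK
  have hle : ∀ y ∈ K, ⟪v, y⟫ ≤ ⟪v, x⟫ := by
    intro y hy
    have h1 : y ∈ closure (interior (K : Set (EuclideanSpace ℝ (Fin n)))) := by
      rw [K.convex.closure_interior_eq_closure_of_nonempty_interior ⟨0, hK⟩]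
      exact subset_closure hy
    exact closure_minimal (t := {y | ⟪v, y⟫ ≤ ⟪v, x⟫}) (fun z hz => (hf z hz).le)
      (isClosed_le (by fun_prop) (by fun_prop)) h1
  have hxv : supportFn K v = ⟪v, x⟫ := by
    refine le_antisymm ?_ (inner_le_supportFn K v (K.isClosed.frontier_subset hx))
    obtain ⟨y, hy, h⟩ := exists_supportFn_eq K v
    rw [h]
    exact hle y hy
  refine ⟨‖v‖⁻¹ • v, mem_sphericalImage_singleton.2 ⟨norm_smul_inv_norm hv, hx, ?_⟩⟩
  rw [supportFn_smul K (by positivity), hxv, inner_smul_right, real_inner_comm]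

/-! ### Regularity of the Gauss map -/

theorem isClosed_setOf_exists_sphericalImage (K : ConvexBody (EuclideanSpace ℝ (Fin n)))
    {F : Set (EuclideanSpace ℝ (Fin n) × EuclideanSpace ℝ (Fin n))} (hF : IsClosed F) :
    IsClosed {x | ∃ u ∈ sphericalImage K {x}, ∃ v ∈ sphericalImage K {x}, (u, v) ∈ F} := by
  obtain ⟨C, hC⟩ := exists_lipschitzWith_supportFn K
  have hcont : Continuous (supportFn K) := hC.continuous
  have hfr : IsCompact (frontier (K : Set (EuclideanSpace ℝ (Fin n)))) :=
    K.isCompact.of_isClosed_subset isClosed_frontier K.isClosed.frontier_subset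
  have hS := isCompact_sphere (0 : EuclideanSpace ℝ (Fin n)) 1
  have hk : IsCompact ((frontier (K : Set (EuclideanSpace ℝ (Fin n))) ×ˢ
      (sphere (0 : EuclideanSpace ℝ (Fin n)) 1 ×ˢ sphere (0 : EuclideanSpace ℝ (Fin n)) 1)) ∩
      ({q | ⟪q.1, q.2.1⟫ = supportFn K q.2.1} ∩ ({q | ⟪q.1, q.2.2⟫ = supportFn K q.2.2} ∩
        {q | q.2 ∈ F}))) :=
    (hfr.prod (hS.prod hS)).inter_right
      ((isClosed_eq (by fun_prop) (by fun_prop)).inter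
        ((isClosed_eq (by fun_prop) (by fun_prop)).inter (hF.preimage continuous_snd)))
  convert (hk.image continuous_fst).isClosed using 1
  ext x
  simp only [mem_sphericalImage_singleton, mem_ofPred_eq, mem_image, mem_inter_iff, mem_prod,
    Prod.exists, mem_sphere, dist_zero_right]
  grind

theorem measurableSet_isRegularPoint {K : ConvexBody (EuclideanSpace ℝ (Fin n))}
    (hK : (0 : EuclideanSpace ℝ (Fin n)) ∈ interior (K : Set (EuclideanSpace ℝ (Fin n)))) :
    MeasurableSet {x | IsRegularPoint K x} := by
  have : {x | IsRegularPoint K x} = frontier (K : Set (EuclideanSpace ℝ (Fin n))) \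
      ⋃ k : ℕ, {x | ∃ u ∈ sphericalImage K {x}, ∃ v ∈ sphericalImage K {x},
        (u, v) ∈ {q : EuclideanSpace ℝ (Fin n) × EuclideanSpace ℝ (Fin n) |
          1 / ((k : ℝ) + 1) ≤ ‖q.1 - q.2‖}} := by
    ext x
    simp only [mem_ofPred_eq, Set.mem_sdiff, mem_iUnion, not_exists, not_and, not_le]
    constructor
    · rintro ⟨hx, hx'⟩
      refine ⟨hx, fun k u hu v hv => ?_⟩
      rw [hx'.unique hu hv, sub_self, norm_zero]
      positivity
    · rintro ⟨hx, h⟩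
      obtain ⟨u, hu⟩ := sphericalImage_singleton_nonempty hK hx
      refine ⟨hx, u, hu, fun v hv => ?_⟩
      by_contra hne
      obtain ⟨k, hk⟩ := exists_nat_one_div_lt (norm_pos_iff.2 (sub_ne_zero.2 hne))
      exact absurd (h k v hv u hu) (not_lt.2 hk.le)
  rw [this]
  refine isClosed_frontier.measurableSet.diff (MeasurableSet.iUnion fun k => ?_)
  exact (isClosed_setOf_exists_sphericalImage K
    (isClosed_le (by fun_prop) (by fun_prop))).measurableSet

theorem continuousOn_gaussMap (K : ConvexBody (EuclideanSpace ℝ (Fin n))) :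
    ContinuousOn (gaussMap K) {x | IsRegularPoint K x} := by
  intro x hx
  rw [ContinuousWithinAt, tendsto_def]
  intro V hV
  obtain ⟨O, hOV, hO, hxO⟩ := _root_.mem_nhds_iff.1 hV
  have hcl := isClosed_setOf_exists_sphericalImage K
    (F := {q | q.1 ∈ Oᶜ}) (hO.isClosed_compl.preimage continuous_fst)
  refine mem_nhdsWithin.2 ⟨_, hcl.isOpen_compl, ?_, ?_⟩
  · rintro ⟨u, hu, _, _, huO⟩
    rw [eq_gaussMap hx hu] at huO
    exact huO hxO
  · rintro y ⟨hy, hyr⟩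
    by_contra hyV
    exact hy ⟨_, gaussMap_mem K hyr, _, gaussMap_mem K hyr, fun h => hyV (hOV h)⟩

theorem measurable_gaussMap {K : ConvexBody (EuclideanSpace ℝ (Fin n))}
    (hK : (0 : EuclideanSpace ℝ (Fin n)) ∈ interior (K : Set (EuclideanSpace ℝ (Fin n)))) :
    Measurable (gaussMap K) := by
  classical
  have h := (continuousOn_gaussMap K).measurable_piecewise
    (g := fun _ => 0) continuousOn_const (measurableSet_isRegularPoint hK)
  convert h using 1
  ext1 x
  by_cases hx : IsRegularPoint K x
  · rw [piecewise_eq_of_mem _ _ _ (show x ∈ {x | IsRegularPoint K x} from hx)]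
  · rw [piecewise_eq_of_notMem _ _ _ (show x ∉ {x | IsRegularPoint K x} from hx), gaussMap,
      dif_neg hx]

/-- The chord between two boundary points makes with a normal at one endpoint an angle whose
cosine is controlled by the distance between the normals at the two endpoints. -/
theorem abs_inner_sub_le {K : ConvexBody (EuclideanSpace ℝ (Fin n))}
    {y z u v : EuclideanSpace ℝ (Fin n)} (hu : u ∈ sphericalImage K {y})
    (hv : v ∈ sphericalImage K {z}) : |⟪u, y - z⟫| ≤ ‖u - v‖ * ‖y - z‖ := by
  rw [mem_sphericalImage_singleton] at hu hv
  have h1 := inner_le_supportFn K u (K.isClosed.frontier_subset hv.2.1)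
  have h2 := inner_le_supportFn K v (K.isClosed.frontier_subset hu.2.1)
  rw [← hu.2.2, real_inner_comm] at h1
  rw [← hv.2.2, real_inner_comm v z] at h2
  rw [real_inner_comm u y, real_inner_comm u z] at h1
  have h3 : 0 ≤ ⟪u, y - z⟫ := by rw [inner_sub_right]; linarith
  have h4 : ⟪v, y - z⟫ ≤ 0 := by rw [inner_sub_right]; linarith
  rw [abs_of_nonneg h3]
  calc ⟪u, y - z⟫ ≤ ⟪u, y - z⟫ - ⟪v, y - z⟫ := by linarith
    _ = ⟪u - v, y - z⟫ := by rw [inner_sub_left]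
    _ ≤ _ := real_inner_le_norm _ _

/-! ### Linear images -/

/-- The map `u ↦ A u / ‖A u‖` induced by a linear map `A` on the unit sphere. -/
noncomputable def normalizedMap (A : EuclideanSpace ℝ (Fin n) →ₗ[ℝ] EuclideanSpace ℝ (Fin n))
    (u : EuclideanSpace ℝ (Fin n)) : EuclideanSpace ℝ (Fin n) :=
  ‖A u‖⁻¹ • A u

section Contragredient

variable {φ A : EuclideanSpace ℝ (Fin n) →ₗ[ℝ] EuclideanSpace ℝ (Fin n)}

/-! The hypothesis `∀ u x, ⟪A u, φ x⟫ = ⟪u, x⟫` says that `φ` is invertible with inverse transpose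
`A`. -/

theorem injective_of_inner (hA : ∀ u x, ⟪A u, φ x⟫ = ⟪u, x⟫) : Function.Injective A := by
  refine (injective_iff_map_eq_zero A).2 fun u hu => ?_
  have := hA u u
  rw [hu, inner_zero_left] at this
  exact inner_self_eq_zero.1 this.symm

theorem inner_swap (hA : ∀ u x, ⟪A u, φ x⟫ = ⟪u, x⟫) (u x : EuclideanSpace ℝ (Fin n)) :
    ⟪φ u, A x⟫ = ⟪u, x⟫ := by
  rw [real_inner_comm, hA, real_inner_comm]

theorem det_mul_det_of_inner (hA : ∀ u x, ⟪A u, φ x⟫ = ⟪u, x⟫) :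
    LinearMap.det A * LinearMap.det φ = 1 := by
  have h1 : A.adjoint ∘ₗ φ = LinearMap.id := by
    refine LinearMap.ext fun x => ext_inner_left ℝ fun u => ?_
    rw [LinearMap.comp_apply, LinearMap.adjoint_inner_right, hA, LinearMap.id_apply]
  have h2 : LinearMap.det A.adjoint = LinearMap.det A := by
    rw [← LinearMap.det_toMatrix (EuclideanSpace.basisFun (Fin n) ℝ).toBasis,
      LinearMap.toMatrix_adjoint, Matrix.det_conjTranspose, LinearMap.det_toMatrix, star_trivial]
  rw [← h2, ← LinearMap.det_comp, h1, LinearMap.det_id]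

theorem supportFn_linearImage (K : ConvexBody (EuclideanSpace ℝ (Fin n)))
    (hA : ∀ u x, ⟪A u, φ x⟫ = ⟪u, x⟫) (u : EuclideanSpace ℝ (Fin n)) :
    supportFn (linearImage φ K) (A u) = supportFn K u := by
  have : ((linearImage φ K : ConvexBody _) : Set (EuclideanSpace ℝ (Fin n))) = φ '' K := rfl
  simp only [supportFn, this, image_image, hA]

theorem norm_map_pos (hA : ∀ u x, ⟪A u, φ x⟫ = ⟪u, x⟫) {u : EuclideanSpace ℝ (Fin n)}
    (hu : ‖u‖ = 1) : 0 < ‖A u‖ := by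
  refine norm_pos_iff.2 fun h => ?_
  rw [injective_of_inner hA (h.trans (map_zero A).symm), norm_zero] at hu
  exact zero_ne_one hu

theorem norm_normalizedMap (hA : ∀ u x, ⟪A u, φ x⟫ = ⟪u, x⟫) {u : EuclideanSpace ℝ (Fin n)}
    (hu : ‖u‖ = 1) : ‖normalizedMap A u‖ = 1 :=
  norm_smul_inv_norm (norm_pos_iff.1 (norm_map_pos hA hu))

theorem supportFn_linearImage_normalizedMap (K : ConvexBody (EuclideanSpace ℝ (Fin n)))
    (hA : ∀ u x, ⟪A u, φ x⟫ = ⟪u, x⟫) (u : EuclideanSpace ℝ (Fin n)) :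
    supportFn (linearImage φ K) (normalizedMap A u) = ‖A u‖⁻¹ * supportFn K u := by
  rw [normalizedMap, supportFn_smul _ (by positivity), supportFn_linearImage K hA]

theorem frontier_linearImage (K : ConvexBody (EuclideanSpace ℝ (Fin n)))
    (hA : ∀ u x, ⟪A u, φ x⟫ = ⟪u, x⟫) :
    frontier (linearImage φ K : Set (EuclideanSpace ℝ (Fin n))) =
      φ '' frontier (K : Set (EuclideanSpace ℝ (Fin n))) := by
  have hinj : Function.Injective φ := injective_of_inner (inner_swap hA)
  let e := (LinearEquiv.ofInjectiveEndo φ hinj).toContinuousLinearEquiv.toHomeomorph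
  exact (e.image_frontier K).symm

/-- Normals transform by the inverse transpose, followed by normalization. -/
theorem sphericalImage_linearImage (K : ConvexBody (EuclideanSpace ℝ (Fin n)))
    (hA : ∀ u x, ⟪A u, φ x⟫ = ⟪u, x⟫) (β : Set (EuclideanSpace ℝ (Fin n))) :
    sphericalImage (linearImage φ K) (φ '' β) = normalizedMap A '' sphericalImage K β := by
  have hφinj : Function.Injective φ := injective_of_inner (inner_swap hA)
  have hAsurj : Function.Surjective A := LinearMap.injective_iff_surjective.1
    (injective_of_inner hA)
  ext v
  constructor
  · rintro ⟨hv, _, ⟨x, hx, rfl⟩, hxf, hxv⟩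
    obtain ⟨u, rfl⟩ := hAsurj v
    have hu : u ≠ 0 := by rintro rfl; simp at hv
    have hu' : 0 < ‖u‖ := norm_pos_iff.2 hu
    rw [frontier_linearImage K hA] at hxf
    rw [supportFn_linearImage K hA, inner_swap hA] at hxv
    refine ⟨‖u‖⁻¹ • u, ⟨norm_smul_inv_norm hu, x, hx, hφinj.mem_set_image.1 hxf, ?_⟩, ?_⟩
    · rw [supportFn_smul _ (by positivity), inner_smul_right, hxv]
    · rw [normalizedMap, map_smul, norm_smul, hv, norm_inv, norm_norm, mul_one, inv_inv,
        smul_smul, mul_inv_cancel₀ hu'.ne', one_smul]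
  · rintro ⟨u, ⟨hu, x, hx, hxf, hxu⟩, rfl⟩
    refine ⟨norm_normalizedMap hA hu, φ x, mem_image_of_mem φ hx, ?_, ?_⟩
    · rw [frontier_linearImage K hA]
      exact mem_image_of_mem φ hxf
    · rw [supportFn_linearImage_normalizedMap K hA, normalizedMap, inner_smul_right,
        inner_swap hA, hxu]

theorem sphericalImage_linearImage_singleton (K : ConvexBody (EuclideanSpace ℝ (Fin n)))
    (hA : ∀ u x, ⟪A u, φ x⟫ = ⟪u, x⟫) {x : EuclideanSpace ℝ (Fin n)}
    (hx : IsRegularPoint K x) :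
    sphericalImage (linearImage φ K) {φ x} = {normalizedMap A (gaussMap K x)} := by
  rw [← image_singleton, sphericalImage_linearImage K hA,
    sphericalImage_eq_gaussMap_image (singleton_subset_iff.2 hx), image_singleton, image_singleton]

theorem gaussMap_linearImage (K : ConvexBody (EuclideanSpace ℝ (Fin n)))
    (hA : ∀ u x, ⟪A u, φ x⟫ = ⟪u, x⟫) {x : EuclideanSpace ℝ (Fin n)}
    (hx : IsRegularPoint K x) :
    gaussMap (linearImage φ K) (φ x) = normalizedMap A (gaussMap K x) := by
  have h := sphericalImage_linearImage_singleton K hA hx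
  have hr : IsRegularPoint (linearImage φ K) (φ x) := by
    refine ⟨?_, normalizedMap A (gaussMap K x), ?_, fun v hv => ?_⟩
    · rw [frontier_linearImage K hA]
      exact mem_image_of_mem φ hx.1
    · simp only [h, mem_singleton_iff]
    · simpa [h] using hv
  exact (eq_gaussMap hr (h ▸ mem_singleton _)).symm

/-! ### Change of variables for the curvature measures -/

theorem abs_inner_sub_le_of_norm_eq_one {u y z : EuclideanSpace ℝ (Fin n)} (hy : ‖y‖ = 1)
    (hz : ‖z‖ = 1) {ε : ℝ} (hyu : ‖y - u‖ ≤ ε) (hzu : ‖z - u‖ ≤ ε) :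
    |⟪u, y - z⟫| ≤ ε * ‖y - z‖ := by
  have h0 : ⟪y + z, y - z⟫ = 0 := by
    rw [real_inner_add_sub_eq_zero_iff, hy, hz]
  have h1 : ⟪u, y - z⟫ = -⟪(1 / 2 : ℝ) • ((y - u) + (z - u)), y - z⟫ := by
    have : (1 / 2 : ℝ) • ((y - u) + (z - u)) = (1 / 2 : ℝ) • (y + z) - u := by module
    rw [this, inner_sub_left, inner_smul_left, h0]; simp
  rw [h1, abs_neg]
  refine (abs_real_inner_le_norm _ _).trans ?_
  gcongr
  rw [norm_smul]
  have := norm_add_le (y - u) (z - u)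
  norm_num
  linarith

theorem hasStrictFDerivAt_normalizedMap (hA : ∀ u x, ⟪A u, φ x⟫ = ⟪u, x⟫)
    {u : EuclideanSpace ℝ (Fin n)} (hu : ‖u‖ = 1) :
    ∃ D : EuclideanSpace ℝ (Fin n) →L[ℝ] EuclideanSpace ℝ (Fin n),
      HasStrictFDerivAt (normalizedMap A) D u ∧
      ∀ w, D w = ‖A u‖⁻¹ • (A w - ⟪normalizedMap A u, A w⟫ • normalizedMap A u) := by
  have hpos := norm_map_pos hA hu
  have hne : ‖A u‖ ≠ 0 := hpos.ne'
  set a := A.toContinuousLinearMap with ha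
  have haA : ∀ x, a x = A x := fun x => rfl
  have h1 : HasStrictFDerivAt (fun x => ‖a x‖ ^ 2) ((2 • (innerSL ℝ (a u))).comp a) u :=
    HasStrictFDerivAt.comp u (hasStrictFDerivAt_norm_sq (a u)) a.hasStrictFDerivAt
  have hs : √(‖a u‖ ^ 2) = ‖A u‖ := Real.sqrt_sq (norm_nonneg _)
  have h2 := h1.sqrt (pow_ne_zero 2 hne)
  have h3 := (hasStrictDerivAt_inv (x := √(‖a u‖ ^ 2)) (by rw [hs]; exact hne)
    ).comp_hasStrictFDerivAt u h2
  have h4 := h3.smul a.hasStrictFDerivAt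
  refine ⟨_, h4.congr_of_eventuallyEq (Eventually.of_forall fun x => ?_), fun w => ?_⟩
  · simp [normalizedMap, haA, Real.sqrt_sq]
  · simp only [normalizedMap, add_apply, smul_apply, ContinuousLinearMap.smulRight_apply,
      ContinuousLinearMap.comp_apply, innerSL_apply_apply, haA, real_inner_smul_left,
      smul_eq_mul, Function.comp_apply, nsmul_eq_mul, Nat.cast_ofNat]
    rw [smul_sub, sub_eq_add_neg, smul_smul, smul_smul, ← neg_smul]
    rw [haA] at hs
    rw [hs]
    congr 2
    field_simp

/-- Near `u`, the map `u ↦ A u / ‖A u‖` scales the measure of the sphere almost by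
`|det A| / ‖A u‖ ^ n`. -/
theorem exists_euclideanHausdorffMeasure_normalizedMap_comparison
    (hA : ∀ u x, ⟪A u, φ x⟫ = ⟪u, x⟫) {u : EuclideanSpace ℝ (Fin n)} (hu : ‖u‖ = 1)
    {δ : ℝ} (hδ : 1 < δ) :
    ∃ U ∈ 𝓝 u, ∀ ω ⊆ U, (∀ y ∈ ω, ‖y‖ = 1) →
      μHE[n - 1] (normalizedMap A '' ω) ≤ ENNReal.ofReal δ *
        (ENNReal.ofReal (|LinearMap.det A| * (‖A u‖ ^ n)⁻¹) * μHE[n - 1] ω) ∧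
      ENNReal.ofReal (|LinearMap.det A| * (‖A u‖ ^ n)⁻¹) * μHE[n - 1] ω ≤
        ENNReal.ofReal δ * μHE[n - 1] (normalizedMap A '' ω) := by
  have hpos := norm_map_pos hA hu
  set c := ‖A u‖ with hc
  set v := normalizedMap A u with hv
  have hv1 : ‖v‖ = 1 := norm_normalizedMap hA hu
  have hAu : A u = c • v := by
    rw [hv, normalizedMap, smul_smul, mul_inv_cancel₀ hpos.ne', one_smul]
  have hvv : ⟪v, v⟫ = 1 := by rw [real_inner_self_eq_norm_sq, hv1, one_pow]
  have huu : ⟪u, u⟫ = 1 := by rw [real_inner_self_eq_norm_sq, hu, one_pow]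
  -- `T` is the derivative of the normalized map on `uᗮ`, extended by `T u = v`. It is `‖A u‖⁻¹ • A`
  -- composed with a transvection, which gives its determinant.
  set ℓ : Module.Dual ℝ (EuclideanSpace ℝ (Fin n)) :=
    (innerₗ _ u) - c⁻¹ • ((innerₗ _ v) ∘ₗ A) with hℓ
  have hℓa : ∀ w, ℓ w = ⟪u, w⟫ - c⁻¹ * ⟪v, A w⟫ := fun w => rfl
  set T : EuclideanSpace ℝ (Fin n) →ₗ[ℝ] EuclideanSpace ℝ (Fin n) :=
    c⁻¹ • (A ∘ₗ LinearMap.transvection ℓ u) with hT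
  have hTa : ∀ w, T w = c⁻¹ • (A w - ⟪v, A w⟫ • v) + ⟪u, w⟫ • v := by
    intro w
    have e : c⁻¹ * (⟪u, w⟫ - c⁻¹ * ⟪v, A w⟫) * c = ⟪u, w⟫ - c⁻¹ * ⟪v, A w⟫ := by field_simp
    rw [hT, LinearMap.smul_apply, LinearMap.comp_apply, LinearMap.transvection.apply,
      map_add, map_smul, hAu, hℓa, smul_add, smul_smul, smul_smul, e]
    module
  have hdet : |LinearMap.det T| = |LinearMap.det A| * (c ^ n)⁻¹ := by
    rw [hT, LinearMap.det_smul, LinearMap.det_comp, LinearMap.transvection.det, hℓa, hAu,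
      inner_smul_right, hvv, huu, finrank_euclideanSpace_fin, mul_one, inv_mul_cancel₀ hpos.ne',
      sub_self, add_zero, mul_one, abs_mul, abs_of_pos (by positivity : 0 < c⁻¹ ^ n), inv_pow,
      mul_comm]
  have hdetA : LinearMap.det A ≠ 0 := left_ne_zero_of_mul_eq_one (det_mul_det_of_inner hA)
  have hTu : T u = v := by
    rw [hTa, hAu, inner_smul_right, hvv, huu]; simp
  have hTo : ∀ w, ⟪u, w⟫ = 0 → ⟪v, T w⟫ = 0 := by
    intro w hw
    rw [hTa, hw, zero_smul, add_zero, inner_smul_right, inner_sub_right, inner_smul_right, hvv]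
    ring
  obtain ⟨ε, hε, H⟩ := exists_euclideanHausdorffMeasure_image_comparison
    (by
      rw [← abs_ne_zero, hdet]
      exact mul_ne_zero (abs_ne_zero.2 hdetA) (inv_ne_zero (pow_ne_zero _ hpos.ne')))
    hu hv1 hTu hTo hδ
  rw [hdet] at H
  obtain ⟨D, hD, hDa⟩ := hasStrictFDerivAt_normalizedMap hA hu
  obtain ⟨V, hV, hVD⟩ := hD.approximates_deriv_on_nhds (c := (ε / 2).toNNReal)
    (Or.inr (by simpa using hε))
  refine ⟨V ∩ ball u (ε / 2), inter_mem hV (ball_mem_nhds u (half_pos hε)),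
    fun ω hω hω1 => ?_⟩
  have hchord : ∀ y ∈ ω, ∀ z ∈ ω, |⟪u, y - z⟫| ≤ ε / 2 * ‖y - z‖ := fun y hy z hz =>
    abs_inner_sub_le_of_norm_eq_one (hω1 y hy) (hω1 z hz)
      (mem_ball_iff_norm.1 (hω hy).2).le (mem_ball_iff_norm.1 (hω hz).2).le
  refine H _ ω (fun y hy z hz => (hchord y hy z hz).trans ?_) fun y hy z hz => ?_
  · gcongr
    linarith
  · have h1 := hVD y (hω hy).1 z (hω hz).1
    rw [Real.coe_toNNReal _ (half_pos hε).le] at h1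
    have h2 : normalizedMap A y - normalizedMap A z - T (y - z) =
        (normalizedMap A y - normalizedMap A z - D (y - z)) - ⟪u, y - z⟫ • v := by
      rw [hTa, hDa]; abel
    rw [h2]
    refine (norm_sub_le _ _).trans ?_
    rw [norm_smul, hv1, mul_one, Real.norm_eq_abs]
    linarith [hchord y hy z hz]

/-- Near a regular point `x` with normal `u`, the map `φ` scales the measure of `∂K` almost by
`|det φ| * ‖A u‖`. -/
theorem exists_euclideanHausdorffMeasure_linearMap_comparison
    (K : ConvexBody (EuclideanSpace ℝ (Fin n)))
    (hA : ∀ u x, ⟪A u, φ x⟫ = ⟪u, x⟫) {x : EuclideanSpace ℝ (Fin n)} (hx : IsRegularPoint K x)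
    {δ : ℝ} (hδ : 1 < δ) :
    ∃ U ∈ 𝓝[{x | IsRegularPoint K x}] x, ∀ β ⊆ U ∩ {x | IsRegularPoint K x},
      μHE[n - 1] (φ '' β) ≤ ENNReal.ofReal δ *
        (ENNReal.ofReal (|LinearMap.det φ| * ‖A (gaussMap K x)‖) * μHE[n - 1] β) ∧
      ENNReal.ofReal (|LinearMap.det φ| * ‖A (gaussMap K x)‖) * μHE[n - 1] β ≤
        ENNReal.ofReal δ * μHE[n - 1] (φ '' β) := by
  have hu := norm_gaussMap hx
  set u := gaussMap K x with hu_def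
  have hpos := norm_map_pos hA hu
  set v := normalizedMap A u with hv
  have hv1 : ‖v‖ = 1 := norm_normalizedMap hA hu
  have huu : ⟪u, u⟫ = 1 := by rw [real_inner_self_eq_norm_sq, hu, one_pow]
  obtain ⟨v', hv'⟩ := LinearMap.injective_iff_surjective.1
    (injective_of_inner (inner_swap hA)) v
  -- `T` agrees with `φ` on `uᗮ` and sends `u` to the unit normal `v` of the image of `uᗮ`.
  set T : EuclideanSpace ℝ (Fin n) →ₗ[ℝ] EuclideanSpace ℝ (Fin n) :=
    φ ∘ₗ LinearMap.transvection (innerₗ _ u) (v' - u) with hT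
  have hTa : ∀ w, T w = φ w + ⟪u, w⟫ • (v - φ u) := by
    intro w
    simp [hT, LinearMap.transvection.apply, hv']
  have hdet : |LinearMap.det T| = |LinearMap.det φ| * ‖A u‖ := by
    have h1 : ⟪u, v'⟫ = ‖A u‖ := by
      rw [← hA, hv', hv, normalizedMap, inner_smul_right, real_inner_self_eq_norm_sq]
      field_simp
    rw [hT, LinearMap.det_comp, LinearMap.transvection.det, innerₗ_apply_apply, inner_sub_right,
      huu, h1, add_sub_cancel, abs_mul, abs_norm]
  have hdetφ : LinearMap.det φ ≠ 0 := right_ne_zero_of_mul_eq_one (det_mul_det_of_inner hA)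
  have hTu : T u = v := by rw [hTa, huu, one_smul]; abel
  have hTo : ∀ w, ⟪u, w⟫ = 0 → ⟪v, T w⟫ = 0 := by
    intro w hw
    rw [hTa, hw, zero_smul, add_zero, hv, normalizedMap, real_inner_smul_left, hA, hw, mul_zero]
  obtain ⟨ε, hε, H⟩ := exists_euclideanHausdorffMeasure_image_comparison
    (by
      rw [← abs_ne_zero, hdet]
      exact mul_ne_zero (abs_ne_zero.2 hdetφ) hpos.ne')
    hu hv1 hTu hTo hδ
  rw [hdet] at H
  set η := ε / (3 * (1 + ‖v - φ u‖)) with hη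
  have hden : 0 < 3 * (1 + ‖v - φ u‖) := by positivity
  have hη0 : 0 < η := div_pos hε hden
  have hηε : η * (3 * (1 + ‖v - φ u‖)) = ε := by rw [hη]; field_simp
  have hcont := (continuousOn_gaussMap K) x hx
  refine ⟨gaussMap K ⁻¹' ball u η, hcont (ball_mem_nhds _ hη0), fun β hβ => H φ β ?_ ?_⟩
  all_goals
    intro y hy z hz
    have hy' := hβ hy
    have hz' := hβ hz
    have h1 : ‖gaussMap K y - u‖ < η := by simpa [dist_eq_norm] using hy'.1
    have h2 : ‖gaussMap K z - u‖ < η := by simpa [dist_eq_norm] using hz'.1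
    have h3 := abs_inner_sub_le (gaussMap_mem K hy'.2) (gaussMap_mem K hz'.2)
    have h4 : ‖gaussMap K y - gaussMap K z‖ ≤ 2 * η := by
      have := norm_sub_le (gaussMap K y - u) (gaussMap K z - u)
      rw [sub_sub_sub_cancel_right] at this
      linarith
    have h5 : |⟪u, y - z⟫| ≤ 3 * η * ‖y - z‖ := by
      have e : u = gaussMap K y - (gaussMap K y - u) := by abel
      have h6 : |⟪gaussMap K y - u, y - z⟫| ≤ η * ‖y - z‖ :=
        (abs_real_inner_le_norm _ _).trans (by gcongr)
      rw [e, inner_sub_left]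
      refine (abs_sub _ _).trans ?_
      have : ‖gaussMap K y - gaussMap K z‖ * ‖y - z‖ ≤ 2 * η * ‖y - z‖ := by gcongr
      linarith
    have h7 := norm_nonneg (v - φ u)
    have h8 := norm_nonneg (y - z)
  · refine h5.trans ?_
    gcongr
    nlinarith
  · rw [hTa, map_sub, show φ y - φ z - (φ y - φ z + ⟪u, y - z⟫ • (v - φ u)) =
      -(⟪u, y - z⟫ • (v - φ u)) by abel, norm_neg, norm_smul, Real.norm_eq_abs]
    calc _ ≤ 3 * η * ‖y - z‖ * ‖v - φ u‖ := by gcongr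
      _ = (3 * η * ‖v - φ u‖) * ‖y - z‖ := by ring
      _ ≤ _ := by gcongr; nlinarith

theorem measurableEmbedding_of_inner (hA : ∀ u x, ⟪A u, φ x⟫ = ⟪u, x⟫) :
    MeasurableEmbedding φ :=
  (LinearEquiv.ofInjectiveEndo φ (injective_of_inner
    (inner_swap hA))).toContinuousLinearEquiv.toHomeomorph.measurableEmbedding

/-- The area formula for the restriction of a linear map to the regular part of `∂K`. -/
theorem euclideanHausdorffMeasure_image_regular (K : ConvexBody (EuclideanSpace ℝ (Fin n)))
    (hA : ∀ u x, ⟪A u, φ x⟫ = ⟪u, x⟫) {β : Set (EuclideanSpace ℝ (Fin n))}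
    (hβ : MeasurableSet β) (hβK : β ⊆ {x | IsRegularPoint K x}) :
    μHE[n - 1] (φ '' β) =
      ∫⁻ x in β, ENNReal.ofReal (|LinearMap.det φ| * ‖A (gaussMap K x)‖) ∂μHE[n - 1] := by
  have hφ := measurableEmbedding_of_inner hA
  have hdetφ : LinearMap.det φ ≠ 0 := right_ne_zero_of_mul_eq_one (det_mul_det_of_inner hA)
  have hcA : Continuous A := A.continuous_of_finiteDimensional
  rw [← hφ.comap_apply]
  refine measure_eq_setLIntegral_of_local _ _ ?_ (fun x hx => ?_)
    (fun x hx => ENNReal.ofReal_ne_top) (fun x hx δ hδ => ?_) hβK hβ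
  · exact ENNReal.continuous_ofReal.comp_continuousOn
      (continuousOn_const.mul (hcA.comp_continuousOn (continuousOn_gaussMap K)).norm)
  · have := norm_map_pos hA (norm_gaussMap hx)
    rw [Ne, ENNReal.ofReal_eq_zero, not_le]
    positivity
  · obtain ⟨U, hU, H⟩ := exists_euclideanHausdorffMeasure_linearMap_comparison K hA hx hδ
    refine ⟨U, hU, fun γ hγ _ => ?_⟩
    rw [hφ.comap_apply]
    exact H γ hγ

/-- The zeroth curvature measure of a linear image, on the regular part of the boundary. The Gauss
map is continuous there, so the spherical image of a small set of regular points is small and the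
local comparison on the sphere applies to it. -/
theorem curvatureMeasureZero_linearImage (K : ConvexBody (EuclideanSpace ℝ (Fin n)))
    (hA : ∀ u x, ⟪A u, φ x⟫ = ⟪u, x⟫) {β : Set (EuclideanSpace ℝ (Fin n))}
    (hβ : MeasurableSet β) (hβK : β ⊆ {x | IsRegularPoint K x}) :
    curvatureMeasureZero (linearImage φ K) (φ '' β) =
      ∫⁻ x in β, ENNReal.ofReal (|LinearMap.det A| * (‖A (gaussMap K x)‖ ^ n)⁻¹)
        ∂(curvatureMeasureZero K) := by
  have hφ := measurableEmbedding_of_inner hA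
  have hdetA : LinearMap.det A ≠ 0 := left_ne_zero_of_mul_eq_one (det_mul_det_of_inner hA)
  have hcA : Continuous A := A.continuous_of_finiteDimensional
  rw [← hφ.comap_apply]
  refine measure_eq_setLIntegral_of_local _ _ ?_ (fun x hx => ?_)
    (fun x hx => ENNReal.ofReal_ne_top) (fun x hx δ hδ => ?_) hβK hβ
  · refine ENNReal.continuous_ofReal.comp_continuousOn (continuousOn_const.mul
      (((hcA.comp_continuousOn (continuousOn_gaussMap K)).norm.pow n).inv₀ fun x hx => ?_))
    exact pow_ne_zero _ (norm_map_pos hA (norm_gaussMap hx)).ne'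
  · have := norm_map_pos hA (norm_gaussMap hx)
    rw [Ne, ENNReal.ofReal_eq_zero, not_le]
    positivity
  · obtain ⟨U, hU, H⟩ := exists_euclideanHausdorffMeasure_normalizedMap_comparison hA
      (norm_gaussMap hx) hδ
    refine ⟨gaussMap K ⁻¹' U, continuousOn_gaussMap K x hx hU, fun γ hγ hγm => ?_⟩
    rw [hφ.comap_apply, curvatureMeasureZero_apply _ hγm,
      curvatureMeasureZero_apply _ (hφ.measurableSet_image.2 hγm),
      sphericalImage_linearImage K hA]
    refine H _ ?_ fun u hu => hu.1
    rw [sphericalImage_eq_gaussMap_image (hγ.trans inter_subset_right)]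
    exact image_subset_iff.2 (hγ.trans inter_subset_left)

end Contragredient

/-! ### Finiteness, and almost every boundary point is regular -/

theorem euclideanHausdorffMeasure_sphere_lt_top :
    μHE[n - 1] (sphere (0 : EuclideanSpace ℝ (Fin n)) 1) < ⊤ := by
  -- Near `e` the sphere is the radial image of a bounded piece of the hyperplane `e + eᗮ`.
  refine (isCompact_sphere _ _).measure_lt_top_of_nhdsWithin fun e he => ?_
  rw [mem_sphere_zero_iff_norm] at he
  refine ⟨{u | 1 / 2 < ⟪e, u⟫} ∩ sphere 0 1, inter_mem ?_ self_mem_nhdsWithin, ?_⟩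
  · refine mem_nhdsWithin_of_mem_nhds ((isOpen_lt (by fun_prop) (by fun_prop)).mem_nhds ?_)
    change 1 / 2 < ⟪e, e⟫
    rw [real_inner_self_eq_norm_sq, he]; norm_num
  set F := fun w : (ℝ ∙ e)ᗮ => ‖e + w‖⁻¹ • (e + (w : EuclideanSpace ℝ (Fin n))) with hF
  have hfin : μHE[n - 1] (F '' closedBall 0 3) < ⊤ := by
    refine (euclideanHausdorffMeasure_image_le_of_lipschitzOnWith (n - 1)
      ((lipschitzWith_radial e he).lipschitzOnWith (s := closedBall 0 3))).trans_lt ?_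
    refine ENNReal.mul_lt_top (by finiteness) ?_
    rw [← finrank_orthogonal_span_of_norm_eq_one he]
    exact (isCompact_closedBall _ _).measure_lt_top
  refine (measure_mono ?_).trans_lt hfin
  rintro u ⟨hu, hu1⟩
  rw [mem_sphere_zero_iff_norm] at hu1
  rw [mem_ofPred_eq] at hu
  set t := ⟪e, u⟫ with ht
  have ht0 : 0 < t := by linarith
  have hwmem : t⁻¹ • u - e ∈ (ℝ ∙ e)ᗮ := by
    rw [Submodule.mem_orthogonal_singleton_iff_inner_right, inner_sub_right, inner_smul_right,
      real_inner_self_eq_norm_sq, he, ← ht]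
    field_simp
    norm_num
  refine ⟨⟨t⁻¹ • u - e, hwmem⟩, ?_, ?_⟩
  · rw [mem_closedBall_zero_iff]
    change ‖t⁻¹ • u - e‖ ≤ 3
    refine (norm_sub_le _ _).trans ?_
    have : t⁻¹ ≤ 2 := by rw [inv_le_comm₀ ht0 two_pos]; linarith
    rw [norm_smul, hu1, he, Real.norm_of_nonneg (by positivity)]
    linarith
  · simp only [hF, add_sub_cancel, norm_smul, norm_inv, Real.norm_of_nonneg ht0.le, hu1, mul_one,
      inv_inv]
    rw [smul_smul, mul_inv_cancel₀ ht0.ne', one_smul]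

/-- The polar body `K° = {y : ⟪x, y⟫ ≤ 1 for all x ∈ K}`. -/
def polarBody (K : ConvexBody (EuclideanSpace ℝ (Fin n)))
    (hK : (0 : EuclideanSpace ℝ (Fin n)) ∈ interior (K : Set (EuclideanSpace ℝ (Fin n)))) :
    ConvexBody (EuclideanSpace ℝ (Fin n)) where
  carrier := {y | ∀ x ∈ K, ⟪x, y⟫ ≤ 1}
  convex' := by
    intro y hy z hz a b ha hb hab x hx
    rw [inner_add_right, inner_smul_right, inner_smul_right]
    nlinarith [hy x hx, hz x hx]
  isCompact' := by
    obtain ⟨r, hr, h⟩ := exists_le_supportFn hK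
    refine (isCompact_closedBall 0 r⁻¹).of_isClosed_subset ?_ fun y hy => ?_
    · simp only [ofPred_forall]
      exact isClosed_biInter fun x _ => isClosed_le (by fun_prop) (by fun_prop)
    · obtain ⟨x, hx, hxy⟩ := exists_supportFn_eq K y
      have h1 := hy x hx
      have h2 := h y
      rw [hxy, real_inner_comm] at h2
      rw [mem_closedBall_zero_iff, ← one_div, le_div_iff₀ hr]
      linarith
  nonempty' := ⟨0, fun x _ => by simp⟩

theorem zero_mem_interior_polarBody (K : ConvexBody (EuclideanSpace ℝ (Fin n)))
    (hK : (0 : EuclideanSpace ℝ (Fin n)) ∈ interior (K : Set (EuclideanSpace ℝ (Fin n)))) :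
    (0 : EuclideanSpace ℝ (Fin n)) ∈
      interior (polarBody K hK : Set (EuclideanSpace ℝ (Fin n))) := by
  obtain ⟨R, hR, h⟩ := exists_supportFn_le K
  rw [mem_interior_iff_mem_nhds]
  refine Filter.mem_of_superset (ball_mem_nhds 0 (inv_pos.2 hR)) fun y hy x hx => ?_
  rw [mem_ball_zero_iff] at hy
  rw [real_inner_comm]
  calc ⟪y, x⟫ ≤ supportFn K y := inner_le_supportFn K y hx
    _ ≤ R * ‖y‖ := h y
    _ ≤ R * R⁻¹ := by gcongr
    _ = 1 := mul_inv_cancel₀ hR.ne'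

theorem supportFn_pos {K : ConvexBody (EuclideanSpace ℝ (Fin n))}
    (hK : (0 : EuclideanSpace ℝ (Fin n)) ∈ interior (K : Set (EuclideanSpace ℝ (Fin n))))
    {u : EuclideanSpace ℝ (Fin n)} (hu : ‖u‖ = 1) : 0 < supportFn K u := by
  obtain ⟨r, hr, h⟩ := exists_le_supportFn hK
  have := h u
  rw [hu] at this
  linarith

theorem inv_supportFn_smul_mem_polarBody {K : ConvexBody (EuclideanSpace ℝ (Fin n))}
    (hK : (0 : EuclideanSpace ℝ (Fin n)) ∈ interior (K : Set (EuclideanSpace ℝ (Fin n))))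
    {x u : EuclideanSpace ℝ (Fin n)} (hu : u ∈ sphericalImage K {x}) :
    (supportFn K u)⁻¹ • u ∈ polarBody K hK ∧ ⟪x, (supportFn K u)⁻¹ • u⟫ = 1 := by
  have hpos := supportFn_pos hK hu.1
  refine ⟨fun z hz => ?_, ?_⟩
  · rw [inner_smul_right, inv_mul_le_iff₀ hpos, mul_one, real_inner_comm]
    exact inner_le_supportFn K u hz
  · rw [inner_smul_right, (mem_sphericalImage_singleton.1 hu).2.2, inv_mul_cancel₀ hpos.ne']

/-- The support function of the polar body is the gauge of `K`, hence equals `1` on `∂K`. -/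
theorem supportFn_polarBody {K : ConvexBody (EuclideanSpace ℝ (Fin n))}
    (hK : (0 : EuclideanSpace ℝ (Fin n)) ∈ interior (K : Set (EuclideanSpace ℝ (Fin n))))
    {x : EuclideanSpace ℝ (Fin n)} (hx : x ∈ frontier (K : Set (EuclideanSpace ℝ (Fin n)))) :
    supportFn (polarBody K hK) x = 1 := by
  refine le_antisymm ?_ ?_
  · obtain ⟨y, hy, h⟩ := exists_supportFn_eq (polarBody K hK) x
    rw [h]
    exact hy x (K.isClosed.frontier_subset hx)
  · obtain ⟨u, hu⟩ := sphericalImage_singleton_nonempty hK hx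
    obtain ⟨h1, h2⟩ := inv_supportFn_smul_mem_polarBody hK hu
    rw [← h2]
    exact inner_le_supportFn _ _ h1

theorem ne_zero_of_mem_frontier {K : ConvexBody (EuclideanSpace ℝ (Fin n))}
    (hK : (0 : EuclideanSpace ℝ (Fin n)) ∈ interior (K : Set (EuclideanSpace ℝ (Fin n))))
    {x : EuclideanSpace ℝ (Fin n)} (hx : x ∈ frontier (K : Set (EuclideanSpace ℝ (Fin n)))) :
    x ≠ 0 := by
  rintro rfl
  exact hx.2 hK

/-- The radial parametrization of `∂K` over the unit sphere is Lipschitz. -/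
theorem exists_lipschitzOnWith_radial (K : ConvexBody (EuclideanSpace ℝ (Fin n)))
    (hK : (0 : EuclideanSpace ℝ (Fin n)) ∈ interior (K : Set (EuclideanSpace ℝ (Fin n)))) :
    ∃ (C : ℝ≥0) (f : EuclideanSpace ℝ (Fin n) → EuclideanSpace ℝ (Fin n)),
      LipschitzOnWith C f (sphere 0 1) ∧
      ∀ x ∈ frontier (K : Set (EuclideanSpace ℝ (Fin n))), f (‖x‖⁻¹ • x) = x := by
  obtain ⟨C, hC⟩ := exists_lipschitzWith_supportFn (polarBody K hK)
  obtain ⟨r, hr, hrh⟩ := exists_le_supportFn (zero_mem_interior_polarBody K hK)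
  refine ⟨(r⁻¹ + C * (r⁻¹ * r⁻¹)).toNNReal, fun v => (supportFn (polarBody K hK) v)⁻¹ • v,
    LipschitzOnWith.of_dist_le_mul fun v hv w hw => ?_, fun x hx => ?_⟩
  · rw [mem_sphere_zero_iff_norm] at hv hw
    rw [Real.coe_toNNReal _ (by positivity), dist_eq_norm]
    have hs := hrh v
    have ht := hrh w
    have hst := hC.dist_le_mul v w
    rw [hv, mul_one] at hs
    rw [hw, mul_one] at ht
    rw [Real.dist_eq] at hst
    set s := supportFn (polarBody K hK) v
    set t := supportFn (polarBody K hK) w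
    have hs0 : 0 < s := by linarith
    have ht0 : 0 < t := by linarith
    have hsr : s⁻¹ ≤ r⁻¹ := inv_anti₀ hr hs
    have htr : t⁻¹ ≤ r⁻¹ := inv_anti₀ hr ht
    have e1 : s⁻¹ • v - t⁻¹ • w = s⁻¹ • (v - w) + (s⁻¹ - t⁻¹) • w := by module
    have e2 : |s⁻¹ - t⁻¹| = |s - t| * (s⁻¹ * t⁻¹) := by
      rw [abs_sub_comm s t, show s⁻¹ - t⁻¹ = (t - s) * (s⁻¹ * t⁻¹) by field_simp, abs_mul,
        abs_of_pos (by positivity : 0 < s⁻¹ * t⁻¹)]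
    rw [e1]
    refine (norm_add_le _ _).trans ?_
    rw [norm_smul, norm_smul, hw, mul_one, Real.norm_eq_abs, Real.norm_eq_abs, e2,
      abs_of_pos (inv_pos.2 hs0), ← dist_eq_norm]
    calc s⁻¹ * dist v w + |s - t| * (s⁻¹ * t⁻¹)
        ≤ r⁻¹ * dist v w + C * dist v w * (r⁻¹ * r⁻¹) := by gcongr
      _ = _ := by ring
  · have hx0 : 0 < ‖x‖ := norm_pos_iff.2 (ne_zero_of_mem_frontier hK hx)
    simp only [supportFn_smul _ (inv_nonneg.2 hx0.le), supportFn_polarBody hK hx, mul_one, inv_inv,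
      smul_smul, mul_inv_cancel₀ hx0.ne', one_smul]

theorem euclideanHausdorffMeasure_frontier_lt_top {K : ConvexBody (EuclideanSpace ℝ (Fin n))}
    (hK : (0 : EuclideanSpace ℝ (Fin n)) ∈ interior (K : Set (EuclideanSpace ℝ (Fin n)))) :
    μHE[n - 1] (frontier (K : Set (EuclideanSpace ℝ (Fin n)))) < ⊤ := by
  obtain ⟨C, f, hf, hfx⟩ := exists_lipschitzOnWith_radial K hK
  have hsub : frontier (K : Set (EuclideanSpace ℝ (Fin n))) ⊆ f '' sphere 0 1 := fun x hx =>
    ⟨‖x‖⁻¹ • x, mem_sphere_zero_iff_norm.2 (norm_smul_inv_norm (ne_zero_of_mem_frontier hK hx)),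
      hfx x hx⟩
  refine ((measure_mono hsub).trans
    (euclideanHausdorffMeasure_image_le_of_lipschitzOnWith (n - 1) hf)).trans_lt ?_
  exact ENNReal.mul_lt_top (by finiteness) euclideanHausdorffMeasure_sphere_lt_top

/-- Almost every boundary point is regular: by polarity, the radial projection of a point with two
normals is a normal of the polar body at two points. -/
theorem euclideanHausdorffMeasure_frontier_diff_regular
    {K : ConvexBody (EuclideanSpace ℝ (Fin n))}
    (hK : (0 : EuclideanSpace ℝ (Fin n)) ∈ interior (K : Set (EuclideanSpace ℝ (Fin n)))) :
    μHE[n - 1] (frontier (K : Set (EuclideanSpace ℝ (Fin n))) \ {x | IsRegularPoint K x}) = 0 := by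
  obtain ⟨C, f, hf, hfx⟩ := exists_lipschitzOnWith_radial K hK
  have hS : singularNormals (polarBody K hK) ⊆ sphere 0 1 := fun u hu =>
    mem_sphere_zero_iff_norm.2 hu.1
  have hnull : μHE[n - 1] (f '' singularNormals (polarBody K hK)) = 0 := by
    have := euclideanHausdorffMeasure_image_le_of_lipschitzOnWith (n - 1) (hf.mono hS)
    rwa [null_singularNormals, mul_zero, nonpos_iff_eq_zero] at this
  refine measure_mono_null ?_ hnull
  rintro x ⟨hx, hreg⟩
  have hx0 := ne_zero_of_mem_frontier hK hx
  obtain ⟨u, hu⟩ := sphericalImage_singleton_nonempty hK hx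
  obtain ⟨v, hv, hvu⟩ : ∃ v ∈ sphericalImage K {x}, v ≠ u := by
    by_contra! h
    exact hreg ⟨hx, u, hu, h⟩
  obtain ⟨hu1, hu2⟩ := inv_supportFn_smul_mem_polarBody hK hu
  obtain ⟨hv1, hv2⟩ := inv_supportFn_smul_mem_polarBody hK hv
  refine ⟨‖x‖⁻¹ • x, ⟨norm_smul_inv_norm hx0, _, hu1, _, hv1, fun h => hvu ?_, ?_, ?_⟩, hfx x hx⟩
  · have hpu := supportFn_pos hK hu.1
    have hpv := supportFn_pos hK hv.1
    have hn := congrArg norm h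
    rw [norm_smul, norm_smul, hu.1, hv.1, mul_one, mul_one, norm_inv, norm_inv,
      Real.norm_of_nonneg hpu.le, Real.norm_of_nonneg hpv.le] at hn
    rw [hn] at h
    exact (smul_right_injective _ (inv_ne_zero hpv.ne') h).symm
  · rw [supportFn_smul _ (by positivity), supportFn_polarBody hK hx, real_inner_smul_left, hu2]
  · rw [supportFn_smul _ (by positivity), supportFn_polarBody hK hx, real_inner_smul_left, hv2]

theorem curvatureMeasureZero_univ_lt_top (K : ConvexBody (EuclideanSpace ℝ (Fin n))) :
    curvatureMeasureZero K univ < ⊤ := by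
  rw [curvatureMeasureZero_apply K MeasurableSet.univ]
  exact (measure_mono fun u hu => mem_sphere_zero_iff_norm.2 hu.1).trans_lt
    euclideanHausdorffMeasure_sphere_lt_top

/-! ### Borel functions in place of continuous functions -/

theorem exists_seq_continuous_tendsto_ae {X : Type*} [MeasurableSpace X] [TopologicalSpace X]
    [NormalSpace X] [BorelSpace X] (ρ : Measure X) [IsFiniteMeasure ρ] [ρ.WeaklyRegular]
    {g : X → ℝ} (hg : Measurable g) {m M : ℝ} (hm : ∀ x, m ≤ g x) (hM : ∀ x, g x ≤ M) :
    ∃ G : ℕ → X → ℝ, (∀ k, Continuous (G k)) ∧ (∀ k x, m ≤ G k x) ∧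
      (∀ k x, G k x ≤ max m M) ∧
      ∀ᵐ x ∂ρ, Tendsto (fun k => G k x) atTop (𝓝 (g x)) := by
  have hmem : MemLp g 1 ρ := by
    refine MemLp.of_bound hg.aestronglyMeasurable (max |m| |M|) (ae_of_all _ fun x => ?_)
    exact abs_le_max_abs_abs (hm x) (hM x)
  have happ : ∀ k : ℕ, ∃ f : BoundedContinuousFunction X ℝ,
      eLpNorm (g - ⇑f) 1 ρ ≤ ((k : ℝ≥0∞) + 1)⁻¹ ∧ MemLp f 1 ρ := fun k =>
    hmem.exists_boundedContinuous_eLpNorm_sub_le ENNReal.one_ne_top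
      (ENNReal.inv_ne_zero.2 (by finiteness))
  choose f hf hfm using happ
  have hlim : Tendsto (fun k => eLpNorm (⇑(f k) - g) 1 ρ) atTop (𝓝 0) := by
    have h0 : Tendsto (fun k : ℕ => ((k : ℝ≥0∞) + 1)⁻¹) atTop (𝓝 0) := by
      have := (tendsto_add_atTop_iff_nat 1).2 ENNReal.tendsto_inv_nat_nhds_zero
      simpa using this
    refine tendsto_of_tendsto_of_tendsto_of_le_of_le tendsto_const_nhds h0
      (fun _ => zero_le) fun k => ?_
    rw [eLpNorm_sub_comm]
    exact hf k
  have hmeas := tendstoInMeasure_of_tendsto_eLpNorm one_ne_zero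
    (fun k => (hfm k).aestronglyMeasurable) hg.aestronglyMeasurable hlim
  obtain ⟨ns, -, hns⟩ := hmeas.exists_seq_tendsto_ae
  refine ⟨fun k x => max m (min M (f (ns k) x)), fun k => by fun_prop,
    fun k x => le_max_left _ _, fun k x => max_le_max le_rfl (min_le_left _ _), ?_⟩
  filter_upwards [hns] with x hx
  have : g x = max m (min M (g x)) := by rw [min_eq_right (hM x), max_eq_right (hm x)]
  rw [this]
  exact tendsto_const_nhds.max (tendsto_const_nhds.min hx)

/-- The integral of `g⁻ⁿ` over `∂K` with respect to the zeroth curvature measure. -/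
noncomputable def normalIntegral (K : ConvexBody (EuclideanSpace ℝ (Fin n)))
    (g : EuclideanSpace ℝ (Fin n) → ℝ) : ℝ≥0∞ :=
  ∫⁻ x in frontier (K : Set (EuclideanSpace ℝ (Fin n))),
    ENNReal.ofReal ((g x ^ n)⁻¹) ∂(curvatureMeasureZero K)

/-- The integral of `gᵖ (h_K ∘ ν_K)¹⁻ᵖ` over `∂K` with respect to surface area. -/
noncomputable def surfaceIntegral (p : ℝ) (K : ConvexBody (EuclideanSpace ℝ (Fin n)))
    (g : EuclideanSpace ℝ (Fin n) → ℝ) : ℝ≥0∞ :=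
  ∫⁻ x in frontier (K : Set (EuclideanSpace ℝ (Fin n))),
    ENNReal.ofReal (g x ^ p * supportFn K (gaussMap K x) ^ (1 - p)) ∂(curvatureMeasureTop K)

theorem affineSurfaceArea_eq (p : ℝ) (K : ConvexBody (EuclideanSpace ℝ (Fin n))) :
    affineSurfaceArea p K = ⨅ g ∈ positiveContinuous K,
      normalIntegral K g ^ (p / (n + p)) * surfaceIntegral p K g ^ ((n : ℝ) / (n + p)) :=
  rfl

variable {p : ℝ} {K : ConvexBody (EuclideanSpace ℝ (Fin n))}

theorem supportFn_zero (K : ConvexBody (EuclideanSpace ℝ (Fin n))) : supportFn K 0 = 0 := by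
  simpa using supportFn_smul K le_rfl 0

theorem gaussMap_of_not_isRegularPoint {x : EuclideanSpace ℝ (Fin n)}
    (hx : ¬ IsRegularPoint K x) : gaussMap K x = 0 := by
  rw [gaussMap, dif_neg hx]

/-- The weight in the surface integral is bounded. At a nonregular point its base is `0`, and
`0 ^ (1 - p)` is `0` or `1`. -/
theorem exists_rpow_supportFn_gaussMap_le (p : ℝ)
    (hK : (0 : EuclideanSpace ℝ (Fin n)) ∈ interior (K : Set (EuclideanSpace ℝ (Fin n)))) :
    ∃ B, ∀ x, supportFn K (gaussMap K x) ^ (1 - p) ≤ B := by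
  obtain ⟨r, hr, hrK⟩ := exists_le_supportFn hK
  obtain ⟨R, hR, hRK⟩ := exists_supportFn_le K
  refine ⟨max 1 (max (r ^ (1 - p)) (R ^ (1 - p))), fun x => ?_⟩
  by_cases hx : IsRegularPoint K x
  · have h1 := hrK (gaussMap K x)
    have h2 := hRK (gaussMap K x)
    rw [norm_gaussMap hx, mul_one] at h1 h2
    refine le_trans ?_ (le_max_right _ _)
    rcases le_total 0 (1 - p) with h | h
    · exact (Real.rpow_le_rpow (hr.le.trans h1) h2 h).trans (le_max_right _ _)
    · exact (Real.rpow_le_rpow_of_nonpos hr h1 h).trans (le_max_left _ _)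
  · rw [gaussMap_of_not_isRegularPoint hx, supportFn_zero]
    exact (Real.zero_rpow_le_one _).trans (le_max_left _ _)

theorem supportFn_gaussMap_nonneg
    (hK : (0 : EuclideanSpace ℝ (Fin n)) ∈ interior (K : Set (EuclideanSpace ℝ (Fin n))))
    (x : EuclideanSpace ℝ (Fin n)) : 0 ≤ supportFn K (gaussMap K x) := by
  obtain ⟨r, hr, hrK⟩ := exists_le_supportFn hK
  exact le_trans (by positivity) (hrK _)

theorem measurable_supportFn_gaussMap
    (hK : (0 : EuclideanSpace ℝ (Fin n)) ∈ interior (K : Set (EuclideanSpace ℝ (Fin n)))) :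
    Measurable fun x => supportFn K (gaussMap K x) := by
  obtain ⟨C, hC⟩ := exists_lipschitzWith_supportFn K
  exact hC.continuous.measurable.comp (measurable_gaussMap hK)

theorem curvatureMeasureTop_univ_lt_top
    (hK : (0 : EuclideanSpace ℝ (Fin n)) ∈ interior (K : Set (EuclideanSpace ℝ (Fin n)))) :
    curvatureMeasureTop K univ < ⊤ := by
  rw [curvatureMeasureTop, Measure.restrict_apply_univ]
  exact euclideanHausdorffMeasure_frontier_lt_top hK

theorem normalIntegral_ne_top {g : EuclideanSpace ℝ (Fin n) → ℝ} {m : ℝ} (hm : 0 < m)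
    (hg : ∀ x ∈ frontier (K : Set (EuclideanSpace ℝ (Fin n))), m ≤ g x) :
    normalIntegral K g ≠ ⊤ := by
  refine ((setLIntegral_mono' isClosed_frontier.measurableSet (g := fun _ =>
    ENNReal.ofReal ((m ^ n)⁻¹)) fun x hx => ?_).trans_lt ?_).ne
  · gcongr
    exact hg x hx
  · rw [setLIntegral_const]
    exact ENNReal.mul_lt_top ENNReal.ofReal_lt_top
      ((measure_mono (subset_univ _)).trans_lt (curvatureMeasureZero_univ_lt_top K))

theorem surfaceIntegral_ne_top (hp : 0 < p)
    (hK : (0 : EuclideanSpace ℝ (Fin n)) ∈ interior (K : Set (EuclideanSpace ℝ (Fin n))))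
    {g : EuclideanSpace ℝ (Fin n) → ℝ} {M : ℝ}
    (hg0 : ∀ x ∈ frontier (K : Set (EuclideanSpace ℝ (Fin n))), 0 < g x)
    (hg : ∀ x ∈ frontier (K : Set (EuclideanSpace ℝ (Fin n))), g x ≤ M) :
    surfaceIntegral p K g ≠ ⊤ := by
  obtain ⟨B, hB⟩ := exists_rpow_supportFn_gaussMap_le p hK
  refine ((setLIntegral_mono' isClosed_frontier.measurableSet (g := fun _ =>
    ENNReal.ofReal (M ^ p * B)) fun x hx => ?_).trans_lt ?_).ne
  · have h0 := hg0 x hx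
    exact ENNReal.ofReal_le_ofReal (mul_le_mul (Real.rpow_le_rpow h0.le (hg x hx) hp.le) (hB x)
      (Real.rpow_nonneg (supportFn_gaussMap_nonneg hK x) _)
      (Real.rpow_nonneg (h0.le.trans (hg x hx)) _))
  · rw [setLIntegral_const]
    exact ENNReal.mul_lt_top ENNReal.ofReal_lt_top
      ((measure_mono (subset_univ _)).trans_lt (curvatureMeasureTop_univ_lt_top hK))

theorem affineSurfaceArea_ne_top (hp : 0 < p)
    (hK : (0 : EuclideanSpace ℝ (Fin n)) ∈ interior (K : Set (EuclideanSpace ℝ (Fin n)))) :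
    affineSurfaceArea p K ≠ ⊤ := by
  rw [affineSurfaceArea_eq]
  refine ne_top_of_le_ne_top ?_ (iInf₂_le (fun _ => 1) ⟨continuousOn_const, fun _ _ => one_pos⟩)
  refine ENNReal.mul_ne_top (ENNReal.rpow_ne_top_of_nonneg (by positivity) ?_)
    (ENNReal.rpow_ne_top_of_nonneg (by positivity) ?_)
  · exact normalIntegral_ne_top one_pos fun _ _ => le_rfl
  · exact surfaceIntegral_ne_top hp hK (fun _ _ => one_pos) fun _ _ => le_rfl

/-- In the definition of the affine surface area, bounded Borel functions may be used in place of
continuous functions. -/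
theorem affineSurfaceArea_le_of_measurable (hp : 0 < p)
    (hK : (0 : EuclideanSpace ℝ (Fin n)) ∈ interior (K : Set (EuclideanSpace ℝ (Fin n))))
    {g : EuclideanSpace ℝ (Fin n) → ℝ} (hg : Measurable g) {m M : ℝ} (hm : 0 < m)
    (hmg : ∀ x, m ≤ g x) (hgM : ∀ x, g x ≤ M) :
    affineSurfaceArea p K ≤
      normalIntegral K g ^ (p / (n + p)) * surfaceIntegral p K g ^ ((n : ℝ) / (n + p)) := by
  have : IsFiniteMeasure (curvatureMeasureZero K) := ⟨curvatureMeasureZero_univ_lt_top K⟩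
  have : IsFiniteMeasure (curvatureMeasureTop K) := ⟨curvatureMeasureTop_univ_lt_top hK⟩
  obtain ⟨G, hGc, hGm, hGM, hGlim⟩ := exists_seq_continuous_tendsto_ae
    (curvatureMeasureZero K + curvatureMeasureTop K) hg hmg hgM
  rw [ae_add_measure_iff] at hGlim
  have hG0 : ∀ k x, 0 < G k x := fun k x => hm.trans_le (hGm k x)
  have hg0 : ∀ x, 0 < g x := fun x => hm.trans_le (hmg x)
  obtain ⟨B, hB⟩ := exists_rpow_supportFn_gaussMap_le p hK
  have hsm := measurable_supportFn_gaussMap hK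
  have hsn := supportFn_gaussMap_nonneg hK
  have lim1 : Tendsto (fun k => normalIntegral K (G k)) atTop (𝓝 (normalIntegral K g)) := by
    refine tendsto_lintegral_of_dominated_convergence' (fun _ => ENNReal.ofReal ((m ^ n)⁻¹))
      (fun k => ?_) (fun k => ae_of_all _ fun x => ?_) ?_ ?_
    · have := (hGc k).measurable
      fun_prop
    · have := hGm k x
      exact ENNReal.ofReal_le_ofReal (by gcongr)
    · rw [lintegral_const]
      exact ENNReal.mul_ne_top ENNReal.ofReal_ne_top (measure_ne_top _ _)
    · filter_upwards [ae_restrict_of_ae hGlim.1] with x hx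
      exact ENNReal.tendsto_ofReal ((hx.pow n).inv₀ (pow_ne_zero _ (hg0 x).ne'))
  have lim2 : Tendsto (fun k => surfaceIntegral p K (G k)) atTop
      (𝓝 (surfaceIntegral p K g)) := by
    refine tendsto_lintegral_of_dominated_convergence'
      (fun _ => ENNReal.ofReal ((max m M) ^ p * B))
      (fun k => ?_) (fun k => ae_of_all _ fun x => ?_) ?_ ?_
    · have := (hGc k).measurable
      fun_prop
    · exact ENNReal.ofReal_le_ofReal (mul_le_mul
        (Real.rpow_le_rpow (hG0 k x).le (hGM k x) hp.le) (hB x)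
        (Real.rpow_nonneg (hsn x) _) (Real.rpow_nonneg ((hG0 k x).le.trans (hGM k x)) _))
    · rw [lintegral_const]
      exact ENNReal.mul_ne_top ENNReal.ofReal_ne_top (measure_ne_top _ _)
    · filter_upwards [ae_restrict_of_ae hGlim.2] with x hx
      exact ENNReal.tendsto_ofReal ((hx.rpow_const (Or.inl (hg0 x).ne')).mul_const _)
  have fin1 := normalIntegral_ne_top (K := K) hm fun x _ => hmg x
  have fin2 := surfaceIntegral_ne_top hp hK (fun x _ => hg0 x) fun x _ => hgM x
  have lim := ENNReal.Tendsto.mul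
    ((ENNReal.continuous_rpow_const (y := p / (n + p))).continuousAt.tendsto.comp lim1)
    (Or.inr (ENNReal.rpow_ne_top_of_nonneg (y := (n : ℝ) / (n + p)) (by positivity) fin2))
    ((ENNReal.continuous_rpow_const (y := (n : ℝ) / (n + p))).continuousAt.tendsto.comp lim2)
    (Or.inr (ENNReal.rpow_ne_top_of_nonneg (by positivity) fin1))
  refine ge_of_tendsto lim (Eventually.of_forall fun k => ?_)
  rw [affineSurfaceArea_eq]
  exact iInf₂_le (G k) ⟨(hGc k).continuousOn, fun x _ => hG0 k x⟩

/-! ### Transport of the defining integrals -/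

/-- Change of variables, for a measure known on images of sets through a density. -/
theorem setLIntegral_image_of_density {X Y : Type*} [MeasurableSpace X] [MeasurableSpace Y]
    {φ : X → Y} (hφ : MeasurableEmbedding φ) {μ : Measure X} {ν : Measure Y} {R : Set X}
    (hR : MeasurableSet R) {D : X → ℝ≥0∞} (hD : Measurable D)
    (h : ∀ β ⊆ R, MeasurableSet β → ν (φ '' β) = ∫⁻ x in β, D x ∂μ)
    {f : Y → ℝ≥0∞} (hf : Measurable f) :
    ∫⁻ y in φ '' R, f y ∂ν = ∫⁻ x in R, D x * f (φ x) ∂μ := by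
  have h1 : (ν.comap φ).restrict R = (μ.restrict R).withDensity D := by
    ext s hs
    rw [Measure.restrict_apply hs, hφ.comap_apply, h _ inter_subset_right (hs.inter hR),
      withDensity_apply _ hs, Measure.restrict_restrict hs]
  have h2 : ν.restrict (φ '' R) = ((ν.comap φ).map φ).restrict (φ '' R) := by
    rw [hφ.map_comap, Measure.restrict_restrict (hφ.measurableSet_image.2 hR),
      inter_eq_left.2 (image_subset_range _ _)]
  rw [h2, setLIntegral_map (hφ.measurableSet_image.2 hR) hf hφ.measurable,
    hφ.injective.preimage_image, h1]
  exact lintegral_withDensity_eq_lintegral_mul _ hD (hf.comp hφ.measurable)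

variable {φ A : EuclideanSpace ℝ (Fin n) →ₗ[ℝ] EuclideanSpace ℝ (Fin n)}

theorem zero_mem_interior_linearImage
    (hK : (0 : EuclideanSpace ℝ (Fin n)) ∈ interior (K : Set (EuclideanSpace ℝ (Fin n))))
    (hA : ∀ u x, ⟪A u, φ x⟫ = ⟪u, x⟫) :
    (0 : EuclideanSpace ℝ (Fin n)) ∈
      interior (linearImage φ K : Set (EuclideanSpace ℝ (Fin n))) := by
  let e := (LinearEquiv.ofInjectiveEndo φ
    (injective_of_inner (inner_swap hA))).toContinuousLinearEquiv.toHomeomorph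
  have : interior (linearImage φ K : Set (EuclideanSpace ℝ (Fin n))) =
    e '' interior (K : Set (EuclideanSpace ℝ (Fin n))) := (e.image_interior K).symm
  rw [this]
  exact ⟨0, hK, map_zero φ⟩

theorem isRegularPoint_subset_frontier :
    {x | IsRegularPoint K x} ⊆ frontier (K : Set (EuclideanSpace ℝ (Fin n))) :=
  fun _ hx => hx.1

theorem exists_norm_map_bounds (hA : ∀ u x, ⟪A u, φ x⟫ = ⟪u, x⟫) :
    ∃ a > 0, ∃ b, ∀ u, ‖u‖ = 1 → a ≤ ‖A u‖ ∧ ‖A u‖ ≤ b := by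
  have hc : Continuous fun u => ‖A u‖ := A.continuous_of_finiteDimensional.norm
  obtain ⟨a, ha, haA⟩ := (isCompact_sphere (0 : EuclideanSpace ℝ (Fin n)) 1).exists_forall_le'
    hc.continuousOn (a := 0) fun u hu => norm_map_pos hA (mem_sphere_zero_iff_norm.1 hu)
  obtain ⟨b, hb⟩ := (isCompact_sphere (0 : EuclideanSpace ℝ (Fin n)) 1).exists_bound_of_continuousOn
    hc.continuousOn
  refine ⟨a, ha, b, fun u hu => ⟨haA u (mem_sphere_zero_iff_norm.2 hu), ?_⟩⟩
  simpa using hb u (mem_sphere_zero_iff_norm.2 hu)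

open Classical in
/-- The function on `ℝⁿ` that corresponds under `φ` to a function `g` on `∂K`: at the image of a
regular point `x` it is `g x / ‖A (ν_K x)‖`, elsewhere it takes the constant value `c`. -/
noncomputable def transportedFn (K : ConvexBody (EuclideanSpace ℝ (Fin n)))
    (A : EuclideanSpace ℝ (Fin n) →ₗ[ℝ] EuclideanSpace ℝ (Fin n))
    (g : EuclideanSpace ℝ (Fin n) → ℝ) (c : ℝ) (y : EuclideanSpace ℝ (Fin n)) : ℝ :=
  if IsRegularPoint K (A.adjoint y) then
    g (A.adjoint y) / ‖A (gaussMap K (A.adjoint y))‖ else c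

theorem adjoint_apply_of_inner (hA : ∀ u x, ⟪A u, φ x⟫ = ⟪u, x⟫)
    (x : EuclideanSpace ℝ (Fin n)) : A.adjoint (φ x) = x :=
  ext_inner_left ℝ fun u => by rw [LinearMap.adjoint_inner_right, hA]

theorem transportedFn_of_regular (hA : ∀ u x, ⟪A u, φ x⟫ = ⟪u, x⟫)
    (g : EuclideanSpace ℝ (Fin n) → ℝ) (c : ℝ) {x : EuclideanSpace ℝ (Fin n)}
    (hx : IsRegularPoint K x) :
    transportedFn K A g c (φ x) = g x / ‖A (gaussMap K x)‖ := by
  rw [transportedFn, adjoint_apply_of_inner hA, if_pos hx]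

theorem transportedFn_of_not_regular (hA : ∀ u x, ⟪A u, φ x⟫ = ⟪u, x⟫)
    (g : EuclideanSpace ℝ (Fin n) → ℝ) (c : ℝ) {x : EuclideanSpace ℝ (Fin n)}
    (hx : ¬ IsRegularPoint K x) :
    transportedFn K A g c (φ x) = c := by
  rw [transportedFn, adjoint_apply_of_inner hA, if_neg hx]

theorem measurable_transportedFn
    (hK : (0 : EuclideanSpace ℝ (Fin n)) ∈ interior (K : Set (EuclideanSpace ℝ (Fin n))))
    (hA : ∀ u x, ⟪A u, φ x⟫ = ⟪u, x⟫) {g : EuclideanSpace ℝ (Fin n) → ℝ}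
    (hg : ContinuousOn g (frontier (K : Set (EuclideanSpace ℝ (Fin n))))) (c : ℝ) :
    Measurable (transportedFn K A g c) := by
  classical
  have hcA : Continuous A := A.continuous_of_finiteDimensional
  have h : ContinuousOn (fun x => g x / ‖A (gaussMap K x)‖) {x | IsRegularPoint K x} :=
    (hg.mono isRegularPoint_subset_frontier).div
      (hcA.comp_continuousOn (continuousOn_gaussMap K)).norm
      fun x hx => (norm_map_pos hA (norm_gaussMap hx)).ne'
  have h2 := (h.measurable_piecewise (g := fun _ => c) continuousOn_const
    (measurableSet_isRegularPoint hK)).comp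
    (A.adjoint.continuous_of_finiteDimensional).measurable
  convert h2 using 1
  ext y
  simp only [transportedFn, Function.comp_apply, piecewise, mem_ofPred_eq]

/-- On the image of the regular points the weight `‖A (ν_K x)‖` cancels the density of the image
measure. The other points may carry positive `C₀`-mass, which the factor `c⁻ⁿ` makes negligible for
large `c`. -/
theorem normalIntegral_transportedFn_le
    (hK : (0 : EuclideanSpace ℝ (Fin n)) ∈ interior (K : Set (EuclideanSpace ℝ (Fin n))))
    (hA : ∀ u x, ⟪A u, φ x⟫ = ⟪u, x⟫) {g : EuclideanSpace ℝ (Fin n) → ℝ}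
    (hg : g ∈ positiveContinuous K) (c : ℝ) :
    normalIntegral (linearImage φ K) (transportedFn K A g c) ≤
      ENNReal.ofReal |LinearMap.det A| * normalIntegral K g +
        ENNReal.ofReal ((c ^ n)⁻¹) * curvatureMeasureZero (linearImage φ K) univ := by
  have hφ := measurableEmbedding_of_inner hA
  have hRm := measurableSet_isRegularPoint hK
  have hcA : Continuous A := A.continuous_of_finiteDimensional
  have hgm := measurable_gaussMap hK
  set R := {x | IsRegularPoint K x} with hR
  have hsplit : φ '' frontier (K : Set (EuclideanSpace ℝ (Fin n))) =
      φ '' R ∪ φ '' (frontier (K : Set (EuclideanSpace ℝ (Fin n))) \ R) := by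
    rw [← image_union, union_sdiff_cancel isRegularPoint_subset_frontier]
  rw [normalIntegral, frontier_linearImage K hA, hsplit]
  refine (lintegral_union_le _ _ _).trans (add_le_add ?_ ?_)
  · rw [setLIntegral_image_of_density hφ hRm
      (D := fun x => ENNReal.ofReal (|LinearMap.det A| * (‖A (gaussMap K x)‖ ^ n)⁻¹))
      (by have := hcA.measurable.comp hgm; fun_prop)
      (fun β hβ hβm => curvatureMeasureZero_linearImage K hA hβm hβ)
      (by have := measurable_transportedFn hK hA hg.1 c; fun_prop),
      normalIntegral, ← lintegral_const_mul' _ _ ENNReal.ofReal_ne_top]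
    refine le_trans (le_of_eq (setLIntegral_congr_fun hRm fun x hx => ?_))
      (lintegral_mono_set isRegularPoint_subset_frontier)
    have hw := norm_map_pos hA (norm_gaussMap hx)
    have hgx := hg.2 x hx.1
    rw [transportedFn_of_regular hA g c hx, ← ENNReal.ofReal_mul (by positivity),
      ← ENNReal.ofReal_mul (by positivity)]
    congr 1
    rw [div_pow]
    field_simp
  · calc _ = ∫⁻ y in φ '' (frontier (K : Set (EuclideanSpace ℝ (Fin n))) \ R),
          ENNReal.ofReal ((c ^ n)⁻¹) ∂(curvatureMeasureZero (linearImage φ K)) := by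
          refine setLIntegral_congr_fun (hφ.measurableSet_image.2
            (isClosed_frontier.measurableSet.diff hRm)) ?_
          rintro _ ⟨x, hx, rfl⟩
          simp only
          rw [transportedFn_of_not_regular hA g c hx.2]
      _ ≤ _ := by
          rw [setLIntegral_const]
          gcongr
          exact subset_univ _

/-- The value `c` at images of nonregular points is irrelevant here, since these form a null set. -/
theorem surfaceIntegral_transportedFn_le
    (hK : (0 : EuclideanSpace ℝ (Fin n)) ∈ interior (K : Set (EuclideanSpace ℝ (Fin n))))
    (hA : ∀ u x, ⟪A u, φ x⟫ = ⟪u, x⟫) {g : EuclideanSpace ℝ (Fin n) → ℝ}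
    (hg : g ∈ positiveContinuous K) (c : ℝ) :
    surfaceIntegral p (linearImage φ K) (transportedFn K A g c) ≤
      ENNReal.ofReal |LinearMap.det φ| * surfaceIntegral p K g := by
  have hφ := measurableEmbedding_of_inner hA
  have hK' := zero_mem_interior_linearImage hK hA
  have hRm := measurableSet_isRegularPoint hK
  have hcA : Continuous A := A.continuous_of_finiteDimensional
  have hgm := measurable_gaussMap hK
  set R := {x | IsRegularPoint K x} with hR
  have hsplit : φ '' frontier (K : Set (EuclideanSpace ℝ (Fin n))) =
      φ '' R ∪ φ '' (frontier (K : Set (EuclideanSpace ℝ (Fin n))) \ R) := by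
    rw [← image_union, union_sdiff_cancel isRegularPoint_subset_frontier]
  have hnull : μHE[n - 1] (φ '' (frontier (K : Set (EuclideanSpace ℝ (Fin n))) \ R)) = 0 := by
    have h := euclideanHausdorffMeasure_image_le_of_lipschitzOnWith (n - 1)
      (φ.toContinuousLinearMap.lipschitz.lipschitzOnWith
        (s := frontier (K : Set (EuclideanSpace ℝ (Fin n))) \ R))
    rwa [euclideanHausdorffMeasure_frontier_diff_regular hK, mul_zero, nonpos_iff_eq_zero] at h
  rw [surfaceIntegral, curvatureMeasureTop, Measure.restrict_restrict
    isClosed_frontier.measurableSet, inter_self, frontier_linearImage K hA, hsplit]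
  refine (lintegral_union_le _ _ _).trans ?_
  rw [setLIntegral_measure_zero _ _ hnull, add_zero, setLIntegral_image_of_density hφ hRm
      (D := fun x => ENNReal.ofReal (|LinearMap.det φ| * ‖A (gaussMap K x)‖))
      (by have := hcA.measurable.comp hgm; fun_prop)
      (fun β hβ hβm => euclideanHausdorffMeasure_image_regular K hA hβm hβ)
      (by
        have h1 := measurable_transportedFn hK hA hg.1 c
        have h2 := measurable_supportFn_gaussMap hK'
        fun_prop),
      surfaceIntegral, curvatureMeasureTop, Measure.restrict_restrict
      isClosed_frontier.measurableSet, inter_self,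
      ← lintegral_const_mul' _ _ ENNReal.ofReal_ne_top]
  refine le_trans (le_of_eq (setLIntegral_congr_fun hRm fun x hx => ?_))
    (lintegral_mono_set isRegularPoint_subset_frontier)
  have hw := norm_map_pos hA (norm_gaussMap hx)
  have hgx := hg.2 x hx.1
  have hs := supportFn_gaussMap_nonneg hK x
  rw [transportedFn_of_regular hA g c hx, gaussMap_linearImage K hA hx,
    supportFn_linearImage_normalizedMap K hA, ← ENNReal.ofReal_mul (by positivity),
    ← ENNReal.ofReal_mul (by positivity)]
  congr 1
  set w := ‖A (gaussMap K x)‖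
  rw [Real.div_rpow hgx.le hw.le, Real.mul_rpow (inv_nonneg.2 hw.le) hs, Real.inv_rpow hw.le]
  -- The area density `w` compensates for `(g / w) ^ p` and `(w⁻¹ * h) ^ (1 - p)`.
  have e : w ^ p * w ^ (1 - p) = w := by
    rw [← Real.rpow_add hw, add_sub_cancel, Real.rpow_one]
  have h1 : 0 < w ^ p := Real.rpow_pos_of_pos hw p
  have h2 : 0 < w ^ (1 - p) := Real.rpow_pos_of_pos hw _
  calc _ = |LinearMap.det φ| * (g x ^ p * supportFn K (gaussMap K x) ^ (1 - p)) *
        (w * (w ^ p * w ^ (1 - p))⁻¹) := by rw [mul_inv]; ring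
    _ = _ := by rw [e, mul_inv_cancel₀ hw.ne', mul_one]

theorem affineSurfaceArea_linearImage_le (hn : n ≠ 0) (hp : 0 < p)
    (hK : (0 : EuclideanSpace ℝ (Fin n)) ∈ interior (K : Set (EuclideanSpace ℝ (Fin n))))
    (hA : ∀ u x, ⟪A u, φ x⟫ = ⟪u, x⟫) :
    affineSurfaceArea p (linearImage φ K) ≤
      ENNReal.ofReal (|LinearMap.det φ| ^ (((n : ℝ) - p) / ((n : ℝ) + p))) *
        affineSurfaceArea p K := by
  have hK' := zero_mem_interior_linearImage hK hA
  have hdet := det_mul_det_of_inner hA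
  have hdφ : 0 < |LinearMap.det φ| := abs_pos.2 (right_ne_zero_of_mul_eq_one hdet)
  have hdA : |LinearMap.det A| = |LinearMap.det φ|⁻¹ :=
    eq_inv_of_mul_eq_one_left (by rw [← abs_mul, hdet, abs_one])
  have hfr : IsCompact (frontier (K : Set (EuclideanSpace ℝ (Fin n)))) :=
    K.isCompact.of_isClosed_subset isClosed_frontier K.isClosed.frontier_subset
  obtain ⟨a, ha, b, hab⟩ := exists_norm_map_bounds hA
  rw [affineSurfaceArea_eq p K, ENNReal.mul_iInf_of_ne (by
    rw [Ne, ENNReal.ofReal_eq_zero, not_le]; positivity) ENNReal.ofReal_ne_top]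
  refine le_iInf fun g => ?_
  rw [ENNReal.mul_iInf_of_ne (by
    rw [Ne, ENNReal.ofReal_eq_zero, not_le]; positivity) ENNReal.ofReal_ne_top]
  refine le_iInf fun hg => ?_
  obtain ⟨m, hm, hmg⟩ := hfr.exists_forall_le' hg.1 (a := 0) hg.2
  obtain ⟨M, hM⟩ := hfr.exists_bound_of_continuousOn hg.1
  have hgM : ∀ x ∈ frontier (K : Set (EuclideanSpace ℝ (Fin n))), g x ≤ M := fun x hx =>
    (le_abs_self _).trans (hM x hx)
  have hX := normalIntegral_ne_top hm hmg
  have hY := surfaceIntegral_ne_top hp hK hg.2 hgM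
  set X := normalIntegral K g
  set Y := surfaceIntegral p K g
  set C' := curvatureMeasureZero (linearImage φ K) univ with hC'
  have hbound : ∀ k : ℕ, affineSurfaceArea p (linearImage φ K) ≤
      (ENNReal.ofReal |LinearMap.det A| * X +
        ENNReal.ofReal ((((k : ℝ) + 1) ^ n)⁻¹) * C') ^ (p / (n + p)) *
      (ENNReal.ofReal |LinearMap.det φ| * Y) ^ ((n : ℝ) / (n + p)) := by
    intro k
    have hk : (0 : ℝ) < (k : ℝ) + 1 := by positivity
    have hmeas := measurable_transportedFn hK hA hg.1 ((k : ℝ) + 1)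
    have hlow : ∀ y, min (m / max b 1) ((k : ℝ) + 1) ≤ transportedFn K A g ((k : ℝ) + 1) y := by
      intro y
      rw [transportedFn]
      split_ifs with hy
      · have hw := norm_map_pos hA (norm_gaussMap hy)
        have h1 := hmg _ hy.1
        have h2 := (hab _ (norm_gaussMap hy)).2
        refine (min_le_left _ _).trans ?_
        exact div_le_div₀ (hm.le.trans h1) h1 hw (h2.trans (le_max_left _ _))
      · exact min_le_right _ _
    have hup : ∀ y, transportedFn K A g ((k : ℝ) + 1) y ≤ max (M / a) ((k : ℝ) + 1) := by
      intro y
      rw [transportedFn]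
      split_ifs with hy
      · have h0 := hg.2 _ hy.1
        have h1 := hgM _ hy.1
        have h2 := (hab _ (norm_gaussMap hy)).1
        refine le_trans ?_ (le_max_left _ _)
        have : 0 ≤ M := h0.le.trans h1
        gcongr
      · exact le_max_right _ _
    refine (affineSurfaceArea_le_of_measurable hp hK' hmeas (by positivity) hlow hup).trans ?_
    gcongr
    · exact normalIntegral_transportedFn_le hK hA hg _
    · exact surfaceIntegral_transportedFn_le hK hA hg _
  have hlim : Tendsto (fun k : ℕ => (ENNReal.ofReal |LinearMap.det A| * X +
        ENNReal.ofReal ((((k : ℝ) + 1) ^ n)⁻¹) * C') ^ (p / (n + p)) *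
      (ENNReal.ofReal |LinearMap.det φ| * Y) ^ ((n : ℝ) / (n + p))) atTop
      (𝓝 ((ENNReal.ofReal |LinearMap.det A| * X) ^ (p / (n + p)) *
        (ENNReal.ofReal |LinearMap.det φ| * Y) ^ ((n : ℝ) / (n + p)))) := by
    refine ENNReal.Tendsto.mul_const ?_ (Or.inr (ENNReal.rpow_ne_top_of_nonneg (by positivity)
      (ENNReal.mul_ne_top ENNReal.ofReal_ne_top hY)))
    refine (ENNReal.continuous_rpow_const (y := p / (n + p))).continuousAt.tendsto.comp ?_
    have h0 : Tendsto (fun k : ℕ => ENNReal.ofReal ((((k : ℝ) + 1) ^ n)⁻¹) * C') atTop (𝓝 0) := by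
      have h1 : Tendsto (fun k : ℕ => (((k : ℝ) + 1) ^ n)⁻¹) atTop (𝓝 0) :=
        ((tendsto_pow_atTop hn).comp
          (tendsto_atTop_add_const_right _ _ tendsto_natCast_atTop_atTop)).inv_tendsto_atTop
      have h2 := ENNReal.Tendsto.mul_const (b := C') (ENNReal.tendsto_ofReal h1)
        (Or.inr (curvatureMeasureZero_univ_lt_top _).ne)
      simpa using h2
    simpa using tendsto_const_nhds.add h0
  refine (ge_of_tendsto' hlim hbound).trans (le_of_eq ?_)
  have hnp : (0 : ℝ) < n + p := by positivity
  rw [ENNReal.mul_rpow_of_nonneg _ _ (by positivity),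
    ENNReal.mul_rpow_of_nonneg _ _ (by positivity),
    hdA, ENNReal.ofReal_rpow_of_pos (by positivity), ENNReal.ofReal_rpow_of_pos hdφ,
    mul_mul_mul_comm, ← ENNReal.ofReal_mul (by positivity)]
  congr 2
  rw [Real.inv_rpow hdφ.le, ← Real.rpow_neg hdφ.le, ← Real.rpow_add hdφ]
  congr 1
  field_simp
  ring

theorem affineSurfaceArea_zero_dim (p : ℝ) (hp : 0 < p)
    (K : ConvexBody (EuclideanSpace ℝ (Fin 0))) : affineSurfaceArea p K = 0 := by
  refine le_antisymm ?_ zero_le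
  rw [affineSurfaceArea_eq]
  refine (iInf₂_le (fun _ => 1) ⟨continuousOn_const, fun _ _ => one_pos⟩).trans ?_
  simp [normalIntegral, surfaceIntegral, hp.ne']

end LpAffine

theorem corollary3p7 (n : ℕ) (p : ℝ) (hp : 0 < p)
    (K : ConvexBody (EuclideanSpace ℝ (Fin n)))
    (hK : (0 : EuclideanSpace ℝ (Fin n)) ∈ interior (K : Set (EuclideanSpace ℝ (Fin n))))
    (φ : EuclideanSpace ℝ (Fin n) →ₗ[ℝ] EuclideanSpace ℝ (Fin n)) (hφ : IsUnit φ) :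
    LpAffine.affineSurfaceArea p K ≠ ⊤ ∧
    LpAffine.affineSurfaceArea p (LpAffine.linearImage φ K) =
      ENNReal.ofReal (|LinearMap.det φ| ^ (((n : ℝ) - p) / ((n : ℝ) + p))) *
        LpAffine.affineSurfaceArea p K := by
  refine ⟨LpAffine.affineSurfaceArea_ne_top hp hK, ?_⟩
  rcases eq_or_ne n 0 with rfl | hn
  · simp [LpAffine.affineSurfaceArea_zero_dim p hp]
  obtain ⟨ψ, hφψ, hψφ⟩ := isUnit_iff_exists.1 hφ
  have hφψ' : ∀ x, φ (ψ x) = x := LinearMap.congr_fun hφψ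
  have hψφ' : ∀ x, ψ (φ x) = x := LinearMap.congr_fun hψφ
  have hA : ∀ u x, ⟪ψ.adjoint u, φ x⟫ = ⟪u, x⟫ := fun u x => by
    rw [LinearMap.adjoint_inner_left, hψφ']
  have hA' : ∀ u x, ⟪φ.adjoint u, ψ x⟫ = ⟪u, x⟫ := fun u x => by
    rw [LinearMap.adjoint_inner_left, hφψ']
  have hdet : LinearMap.det φ * LinearMap.det ψ = 1 := by
    rw [← LinearMap.det_comp]
    exact (congrArg LinearMap.det hφψ).trans LinearMap.det_id
  have hdφ : 0 < |LinearMap.det φ| := abs_pos.2 (left_ne_zero_of_mul_eq_one hdet)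
  refine le_antisymm (LpAffine.affineSurfaceArea_linearImage_le hn hp hK hA) ?_
  have h := LpAffine.affineSurfaceArea_linearImage_le hn hp
    (LpAffine.zero_mem_interior_linearImage hK hA) hA'
  have hid : LpAffine.linearImage ψ (LpAffine.linearImage φ K) = K := by
    refine SetLike.coe_injective ?_
    change ψ '' (φ '' K) = K
    simp [image_image, hψφ']
  rw [hid] at h
  refine (mul_le_mul' le_rfl h).trans (le_of_eq ?_)
  rw [← mul_assoc, ← ENNReal.ofReal_mul (by positivity), ← Real.mul_rpow (abs_nonneg _)
    (abs_nonneg _), ← abs_mul, hdet, abs_one, Real.one_rpow, ENNReal.ofReal_one, one_mul]
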